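/- **Setting.** Let $d\ge 1$, $\Omega=[0,l_1]\times\dots\times[0,l_d]$ with $l_i>0$, and let $\mathcal G=(\mathcal N,\mathcal E)$ be a finite connected simple graph whose node set $\mathcal N$ is a finite set of points of $\Omega$; write $x\sim y$ if $\{x,y\}\in\mathcal E$, and $|\cdot|$ for the Euclidean norm. Let $\Gamma\subset\partial\Omega$. For $x\in\Omega$, $R>0$ let $B_R(x)$ be the set of $z\in\Omega$ such that for every $i$ either $x_i-R\le z_i<x_i+R$, or $z_i=x_i+R=l_i$. Let $\hat V$ be the space of functions $\mathcal N\to\mathbb R$, $V=\{v\in\hat V: v=0\text{ on }\mathcal N\cap\Gamma\}$, $\hat{\mathbf V}=\hat V^n$, $\mathbf V=V^n$, $(\mathbf u,\mathbf v)=\sum_{i=1}^n\sum_{x\in\mathcal N}u_i(x)v_i(x)$. For $\omega\subset\Omega$ put $$|v|_{M,\omega}^2=\sum_{x\in\mathcal N\cap\omega}\frac12\sum_{y\sim x}|x-y|\,v(x)^2,\qquad |v|_{L,\omega}^2=\sum_{x\in\mathcal N\cap\omega}\frac12\sum_{y\sim x}\frac{(v(x)-v(y))^2}{|x-y|},\qquad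 (\mathbf L\mathbf v,\mathbf v)=\sum_{i=1}^n|v_i|_{L,\Omega}^2 .$$ **Assumption 1.** $\mathbf K:\hat{\mathbf V}\to\hat{\mathbf V}$ is linear and symmetric, $\alpha>0$, $\alpha(\mathbf L\mathbf v,\mathbf v)\le(\mathbf K\mathbf v,\mathbf v)\le\beta(\mathbf L\mathbf v,\mathbf v)$ for all $\mathbf v\in\mathbf V$, and for every $\mathbf f\in\hat{\mathbf V}$ there is a unique $\mathbf u\in\mathbf V$ with $(\mathbf K\mathbf u,\mathbf v)=(\mathbf f,\mathbf v)$ for all $\mathbf v\in\mathbf V$. Put $|\mathbf v|_{\mathbf K}=(\mathbf K\mathbf v,\mathbf v)^{1/2}$. **Assumption 2.** $R_0>0$, $\rho>0$, $\sigma\in\mathbb R$, and: (1) $\rho\le(2R)^{-d}|1|^2_{M,B_R(x)}\le\sigma\rho$ for all $R\ge R_0$ and $x\in\Omega$ with $[x_1-R,x_1+R]\times\dots\times[x_d-R,x_d+R]\subset\Omega$; (2) for all $R\ge R_0$, $x\in\Omega$ there is a connected subgraph of $\mathcal G$ that contains all edges with at least one endpoint in $B_R(x)$ and only edges with both endpoints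 in $B_{R+R_0}(x)$; (3) $|x-y|<R_0$ if $x\sim y$; (4) for every $y\in\Gamma$ there is $x\in\mathcal N\cap\Gamma$ with $|x-y|<R_0$. **Constant $\mu$.** Call $\mu\ge0$ a Poincaré constant if for all $R\ge R_0$, $x\in\Omega$: for every $v\in\hat V$ there is $c\in\mathbb R$ with $|v-c|_{M,B_R(x)}\le\mu R|v|_{L,B_{R+R_0}(x)}$; and if $B_R(x)$ contains a node in $\Gamma$, then $|v|_{M,B_R(x)}\le\mu R|v|_{L,B_{R+R_0}(x)}$ for every $v\in V$. **Mesh and preconditioner.** Let $l_i=N_iH$ with $N_i\in\mathbb N$, let $\mathcal T_H$ be the partition of $\Omega$ into the $\prod_i N_i$ boxes $B_{H/2}(x)$ with $x\in\Omega$ and $H^{-1}x_i+\frac12\in\mathbb Z$ for all $i$, and let $\Gamma$ be a union of closed $(d-1)$-dimensional faces of elements. Let $y_1,\dots,y_m$ be the mesh nodes (all points $Ha$ with $a\in\prod_i\{0,\dots,N_i\}$) and $U(y_j)$ the union of the elements $T\in\mathcal T_H$ with $y_j\in\overline T$. Let $\mathbf V_0=V_H^n$, where $V_H$ consists of the restrictions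 to $\mathcal N$ of the continuous functions on $\Omega$ that vanish on $\Gamma$ and are on each $T\in\mathcal T_H$ a linear combination of the monomials $\prod_{i\in S}z_i$, $S\subset\{1,\dots,d\}$. For $1\le j\le m$ let $\mathbf V_j=\{\mathbf v\in\mathbf V:\mathbf v=0\text{ at the nodes outside }U(y_j)\}$. The additive Schwarz preconditioner is $\mathbf B\mathbf r=\sum_{j=0}^m\mathbf w_j$, where $\mathbf w_j\in\mathbf V_j$ and $(\mathbf K\mathbf w_j,\mathbf v)=(\mathbf r,\mathbf v)$ for all $\mathbf v\in\mathbf V_j$. For $\mathbf f\in\hat{\mathbf V}$ let $\mathbf u\in\mathbf V$ satisfy $(\mathbf K\mathbf u,\mathbf v)=(\mathbf f,\mathbf v)$ for all $\mathbf v\in\mathbf V$, and let $\mathbf u^{(\ell)}$ be the iterates of the preconditioned conjugate gradient algorithm with initial guess $\mathbf u^{(0)}\in\mathbf V$: with $\mathbf r_0=\mathbf f-\mathbf K\mathbf u^{(0)}$, $\mathbf p_0=\mathbf B\mathbf r_0$, $$a_\ell=\frac{(\mathbf r_\ell,\mathbf B\mathbf r_\ell)}{(\mathbf K\mathbf p_\ell,\mathbf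 p_\ell)},\quad \mathbf u^{(\ell+1)}=\mathbf u^{(\ell)}+a_\ell\mathbf p_\ell,\quad \mathbf r_{\ell+1}=\mathbf r_\ell-a_\ell\mathbf K\mathbf p_\ell,\quad \mathbf p_{\ell+1}=\mathbf B\mathbf r_{\ell+1}+\frac{(\mathbf r_{\ell+1},\mathbf B\mathbf r_{\ell+1})}{(\mathbf r_\ell,\mathbf B\mathbf r_\ell)}\,\mathbf p_\ell$$ (with $0/0=0$, so that the iteration stays at the solution once it is reached). **Theorem 4.1.** For every $d$ there is a constant $C_d>0$ depending only on $d$ such that the following holds in the setting above. If Assumptions 1 and 2 hold and $H\ge2R_0$, then a Poincaré constant exists, and for every Poincaré constant $\mu$ (provided that $N_i\ge3$ for some $i$, or $\sigma^{1/2}\mu\ge1$), all $\mathbf f\in\hat{\mathbf V}$, $\mathbf u^{(0)}\in\mathbf V$ and $\ell\ge0$, $$|\mathbf u-\mathbf u^{(\ell)}|_{\mathbf K}\le2\left(\frac{\sqrt\kappa-1}{\sqrt\kappa+1}\right)^{\ell}|\mathbf u-\mathbf u^{(0)}|_{\mathbf K},\qquad \sqrt\kappa=C_d\,\beta\,\alpha^{-1}\sigma^{1/2}\mu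 .$$ -/

import Mathlib

noncomputable section

/-- Points of `ℝᵈ`, with the Euclidean norm. -/
abbrev Pt (d : ℕ) : Type := EuclideanSpace ℝ (Fin d)

/-- The closed hyper-rectangle `[0, l₁] × ⋯ × [0, l_d]`. -/
def hyperRect {d : ℕ} (l : Fin d → ℝ) : Set (Pt d) :=
  {z | ∀ i, 0 ≤ z i ∧ z i ≤ l i}

/-- A connected spatial network in the hyper-rectangle `Ω` with side lengths `side`: finitely many
nodes in `Ω`, a connected graph on them, and the Dirichlet part `Γ` of the boundary of `Ω`. -/
structure SpatialNetwork (d : ℕ) where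
  side : Fin d → ℝ
  side_pos : ∀ i, 0 < side i
  nodes : Finset (Pt d)
  nodes_mem : ∀ x ∈ nodes, x ∈ hyperRect side
  graph : SimpleGraph nodes
  connected : graph.Connected
  Γ : Set (Pt d)
  Γ_subset : Γ ⊆ frontier (hyperRect side)

namespace SpatialNetwork

variable {d : ℕ} (G : SpatialNetwork d)

/-- The domain `Ω`. -/
def Ω : Set (Pt d) := hyperRect G.side

/-- The part in `Ω` of the box with centre `x` and side length `2R`. The box is half-open; its
upper face in a direction is included exactly if it lies on the upper face of `Ω`. -/
def box (R : ℝ) (x : Pt d) : Set (Pt d) :=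
  {z | z ∈ G.Ω ∧ ∀ i, x i - R ≤ z i ∧
    (z i < x i + R ∨ (x i + R = G.side i ∧ z i = x i + R))}

/-- The box with centre `x` and side length `2R` does not stick out of `Ω`. -/
def BoxInside (R : ℝ) (x : Pt d) : Prop :=
  ∀ i, 0 ≤ x i - R ∧ x i + R ≤ G.side i

/-! ### Function spaces and quadratic forms -/

/-- Real functions on the nodes. -/
abbrev Fun : Type := G.nodes → ℝ

/-- Functions on the nodes with `n` components. -/
abbrev VFun (n : ℕ) : Type := Fin n → G.Fun

/-- The scalar functions that vanish at the nodes in `Γ`. -/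
def dirichlet : Submodule ℝ G.Fun where
  carrier := {v | ∀ x : G.nodes, (x : Pt d) ∈ G.Γ → v x = 0}
  add_mem' := by
    intro a b ha hb x hx
    simp [ha x hx, hb x hx]
  zero_mem' := by
    intro x _
    rfl
  smul_mem' := by
    intro c a ha x hx
    simp [ha x hx]

/-- The vector-valued functions all of whose components vanish at the nodes in `Γ`. -/
def vdirichlet (n : ℕ) : Submodule ℝ (G.VFun n) :=
  Submodule.pi Set.univ fun _ => G.dirichlet

/-- The inner product `(u, v)` of vector-valued functions. -/
def ip {n : ℕ} (u v : G.VFun n) : ℝ := ∑ i, ∑ x, u i x * v i x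

open Classical in
/-- `(M_ω v, v)`: the sum over the nodes `x ∈ ω` of `½ ∑_{y ∼ x} |x - y| v(x)²`. -/
def massForm (ω : Set (Pt d)) (v : G.Fun) : ℝ :=
  ∑ x : G.nodes, if (x : Pt d) ∈ ω then
    (1 / 2 : ℝ) * ∑ y : G.nodes, if G.graph.Adj x y then
      ‖(x : Pt d) - (y : Pt d)‖ * v x ^ 2 else 0
  else 0

open Classical in
/-- `(L_ω v, v)`: the sum over the nodes `x ∈ ω` of `½ ∑_{y ∼ x} (v(x) - v(y))² / |x - y|`. -/
def lapForm (ω : Set (Pt d)) (v : G.Fun) : ℝ :=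
  ∑ x : G.nodes, if (x : Pt d) ∈ ω then
    (1 / 2 : ℝ) * ∑ y : G.nodes, if G.graph.Adj x y then
      (v x - v y) ^ 2 / ‖(x : Pt d) - (y : Pt d)‖ else 0
  else 0

/-- The semi-norm `|v|_{M,ω}`. -/
def massNorm (ω : Set (Pt d)) (v : G.Fun) : ℝ := √(G.massForm ω v)

/-- The semi-norm `|v|_{L,ω}`. -/
def lapNorm (ω : Set (Pt d)) (v : G.Fun) : ℝ := √(G.lapForm ω v)

/-- `(L v, v)` for vector-valued `v`, with the Laplacian of the whole network acting
componentwise. -/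
def vlapForm {n : ℕ} (v : G.VFun n) : ℝ := ∑ i, G.lapForm G.Ω (v i)

/-- The norm `|v|_K = (K v, v)^{1/2}`. -/
def energyNorm {n : ℕ} (K : G.VFun n →ₗ[ℝ] G.VFun n) (v : G.VFun n) : ℝ := √(G.ip (K v) v)

/-! ### Assumptions on the operator and on the network -/

/-- `u` solves: `u ∈ W` and `(K u, v) = (f, v)` for all `v ∈ W`. -/
def IsSolutionOn {n : ℕ} (K : G.VFun n →ₗ[ℝ] G.VFun n) (W : Submodule ℝ (G.VFun n))
    (f u : G.VFun n) : Prop :=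
  u ∈ W ∧ ∀ v ∈ W, G.ip (K u) v = G.ip f v

/-- The assumptions on the operator `K`. -/
structure OperatorAssumption {n : ℕ} (K : G.VFun n →ₗ[ℝ] G.VFun n) (α β : ℝ) : Prop where
  alpha_pos : 0 < α
  coercive : ∀ v ∈ G.vdirichlet n, α * G.vlapForm v ≤ G.ip (K v) v
  bounded : ∀ v ∈ G.vdirichlet n, G.ip (K v) v ≤ β * G.vlapForm v
  symmetric : ∀ v w : G.VFun n, G.ip (K v) w = G.ip (K w) v
  uniquely_solvable : ∀ f : G.VFun n, ∃! u, G.IsSolutionOn K (G.vdirichlet n) f u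

/-- The assumptions on the network: homogeneity, connectivity, locality, boundary density. -/
structure NetworkAssumption (R₀ σ ρ : ℝ) : Prop where
  scale_pos : 0 < R₀
  density_pos : 0 < ρ
  homogeneity : ∀ R, R₀ ≤ R → ∀ x ∈ G.Ω, G.BoxInside R x →
    ρ ≤ ((2 * R) ^ d)⁻¹ * G.massNorm (G.box R x) 1 ^ 2 ∧
      ((2 * R) ^ d)⁻¹ * G.massNorm (G.box R x) 1 ^ 2 ≤ σ * ρ
  connectivity : ∀ R, R₀ ≤ R → ∀ x ∈ G.Ω, ∃ S : G.graph.Subgraph, S.Connected ∧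
    (∀ y z : G.nodes, G.graph.Adj y z →
      (y : Pt d) ∈ G.box R x ∨ (z : Pt d) ∈ G.box R x → S.Adj y z) ∧
    (∀ y z : G.nodes, S.Adj y z →
      (y : Pt d) ∈ G.box (R + R₀) x ∧ (z : Pt d) ∈ G.box (R + R₀) x)
  locality : ∀ x y : G.nodes, G.graph.Adj x y → ‖(x : Pt d) - (y : Pt d)‖ < R₀
  boundary_density : ∀ y ∈ G.Γ, ∃ x ∈ G.nodes, x ∈ G.Γ ∧ ‖x - y‖ < R₀

/-- `μ` is an admissible constant in the Friedrichs and Poincaré inequalities of the network on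
all scales `R ≥ R₀`. -/
structure IsPoincareConstant (R₀ μ : ℝ) : Prop where
  nonneg : 0 ≤ μ
  friedrichs : ∀ R, R₀ ≤ R → ∀ x ∈ G.Ω, (∃ z ∈ G.nodes, z ∈ G.Γ ∧ z ∈ G.box R x) →
    ∀ v ∈ G.dirichlet,
      G.massNorm (G.box R x) v ≤ μ * R * G.lapNorm (G.box (R + R₀) x) v
  poincare : ∀ R, R₀ ≤ R → ∀ x ∈ G.Ω, ∀ v : G.Fun, ∃ c : ℝ,
    G.massNorm (G.box R x) (fun z => v z - c) ≤ μ * R * G.lapNorm (G.box (R + R₀) x) v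

/-! ### The coarse mesh and the subspaces -/

/-- `x ∈ Ω` is the centre of an element of the mesh with parameter `H`. -/
def IsCenter (H : ℝ) (x : Pt d) : Prop :=
  x ∈ G.Ω ∧ ∀ i, ∃ a : ℤ, H⁻¹ * x i + 1 / 2 = a

/-- The mesh: the boxes of side length `H` around the centres. -/
def mesh (H : ℝ) : Set (Set (Pt d)) :=
  {T | ∃ x, G.IsCenter H x ∧ T = G.box (H / 2) x}

/-- The closed `(d-1)`-dimensional faces of the elements. -/
def IsElementFace (H : ℝ) (F : Set (Pt d)) : Prop :=
  ∃ x, G.IsCenter H x ∧ ∃ i : Fin d, ∃ s : ℝ, (s = 1 ∨ s = -1) ∧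
    F = {z | z i = x i + s * (H / 2) ∧ ∀ j, j ≠ i → |z j - x j| ≤ H / 2}

/-- The mesh is aligned with `Γ`: `Γ` is a union of element faces. -/
def MeshAligned (H : ℝ) : Prop :=
  ∃ 𝓕 : Set (Set (Pt d)), (∀ F ∈ 𝓕, G.IsElementFace H F) ∧ G.Γ = ⋃₀ 𝓕

/-- The patch `U(ω)`: the points in the elements whose closure meets the closure of `ω`. -/
def patch (H : ℝ) (ω : Set (Pt d)) : Set (Pt d) :=
  {x | x ∈ G.Ω ∧ ∃ T ∈ G.mesh H, x ∈ T ∧ (closure T ∩ closure ω).Nonempty}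

/-- The finite element space: functions that are continuous on `Ω`, on every element a linear
combination of the monomials `z ↦ ∏_{i ∈ S} z_i` with `S ⊆ {1, …, d}`, and zero on `Γ`. -/
def feSpace (H : ℝ) : Submodule ℝ (Pt d → ℝ) where
  carrier := {q | ContinuousOn q G.Ω ∧
    (∀ T ∈ G.mesh H, ∃ c : Finset (Fin d) → ℝ, ∀ z ∈ T, q z = ∑ S, c S * ∏ i ∈ S, z i) ∧
    ∀ z ∈ G.Γ, q z = 0}
  add_mem' := by
    rintro a b ⟨ha, ha', ha''⟩ ⟨hb, hb', hb''⟩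
    refine ⟨ha.add hb, fun T hT => ?_, fun z hz => by simp [ha'' z hz, hb'' z hz]⟩
    obtain ⟨c, hc⟩ := ha' T hT
    obtain ⟨e, he⟩ := hb' T hT
    exact ⟨c + e, fun z hz => by
      simp [hc z hz, he z hz, add_mul, Finset.sum_add_distrib]⟩
  zero_mem' :=
    ⟨continuousOn_const, fun _ _ => ⟨0, fun _ _ => by simp⟩, fun _ _ => rfl⟩
  smul_mem' := by
    rintro t a ⟨ha, ha', ha''⟩
    refine ⟨ha.const_smul t, fun T hT => ?_, fun z hz => by simp [ha'' z hz]⟩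
    obtain ⟨c, hc⟩ := ha' T hT
    exact ⟨t • c, fun z hz => by simp [hc z hz, Finset.mul_sum, mul_assoc]⟩

/-- The coarse space: componentwise restrictions of finite element functions to the nodes. -/
def coarseSpace (H : ℝ) (n : ℕ) : Submodule ℝ (G.VFun n) :=
  Submodule.pi Set.univ fun _ =>
    (G.feSpace H).map (LinearMap.funLeft ℝ ℝ (Subtype.val : G.nodes → Pt d))

/-- The functions that satisfy the boundary condition and are zero at the nodes outside `ω`. -/
def localSpace (n : ℕ) (ω : Set (Pt d)) : Submodule ℝ (G.VFun n) where
  carrier := {v | v ∈ G.vdirichlet n ∧ ∀ i, ∀ x : G.nodes, (x : Pt d) ∉ ω → v i x = 0}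
  add_mem' := by
    rintro a b ⟨ha, ha'⟩ ⟨hb, hb'⟩
    exact ⟨Submodule.add_mem _ ha hb, fun i x hx => by simp [ha' i x hx, hb' i x hx]⟩
  zero_mem' := ⟨Submodule.zero_mem _, fun _ _ _ => rfl⟩
  smul_mem' := by
    rintro t a ⟨ha, ha'⟩
    exact ⟨Submodule.smul_mem _ t ha, fun i x hx => by simp [ha' i x hx]⟩

/-- The mesh node with multi-index `a`, in a mesh with `N i` elements in direction `i`. -/
def meshNode (H : ℝ) {N : Fin d → ℕ} (a : (i : Fin d) → Fin (N i + 1)) : Pt d :=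
  WithLp.toLp 2 fun i => H * (a i : ℕ)

/-! ### The additive Schwarz preconditioner and the PCG method -/

open Classical in
/-- The solution `w ∈ W` of `(K w, v) = (r, v)` for all `v ∈ W` (it is unique if `(K ·, ·)` is an
inner product on `W`). -/
def subspaceSolve {n : ℕ} (K : G.VFun n →ₗ[ℝ] G.VFun n) (W : Submodule ℝ (G.VFun n))
    (r : G.VFun n) : G.VFun n :=
  if h : ∃ w, G.IsSolutionOn K W r w then h.choose else 0

/-- The preconditioner `B`: the sum of the solves in the coarse space and in the spaces of
functions supported in the patches of all the mesh nodes. -/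
def schwarz {n : ℕ} (K : G.VFun n →ₗ[ℝ] G.VFun n) (H : ℝ) (N : Fin d → ℕ)
    (r : G.VFun n) : G.VFun n :=
  G.subspaceSolve K (G.coarseSpace H n) r +
    ∑ a : (i : Fin d) → Fin (N i + 1),
      G.subspaceSolve K (G.localSpace n (G.patch H {meshNode H a})) r

/-- The state of the PCG algorithm: iterate, residual, search direction. -/
structure PCGState (n : ℕ) where
  sol : G.VFun n
  res : G.VFun n
  dir : G.VFun n

/-- One step of the preconditioned conjugate gradient algorithm with preconditioner `B`. (Once
`(r, B r) = 0` the iterate stays unchanged, since `0 / 0 = 0`.) -/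
def pcgStep {n : ℕ} (K : G.VFun n →ₗ[ℝ] G.VFun n) (B : G.VFun n → G.VFun n)
    (s : G.PCGState n) : G.PCGState n :=
  let a := G.ip s.res (B s.res) / G.ip (K s.dir) s.dir
  let r := s.res - a • K s.dir
  let b := G.ip r (B r) / G.ip s.res (B s.res)
  { sol := s.sol + a • s.dir
    res := r
    dir := B r + b • s.dir }

/-- The state of the PCG algorithm after `ℓ` steps, with initial guess `u₀`. -/
def pcg {n : ℕ} (K : G.VFun n →ₗ[ℝ] G.VFun n) (B : G.VFun n → G.VFun n) (f u₀ : G.VFun n) :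
    ℕ → G.PCGState n
  | 0 => { sol := u₀, res := f - K u₀, dir := B (f - K u₀) }
  | ℓ + 1 => G.pcgStep K B (pcg K B f u₀ ℓ)

/-- The PCG iterate `u^(ℓ)` with the additive Schwarz preconditioner. -/
def pcgIterate {n : ℕ} (K : G.VFun n →ₗ[ℝ] G.VFun n) (H : ℝ) (N : Fin d → ℕ)
    (f u₀ : G.VFun n) (ℓ : ℕ) : G.VFun n :=
  (G.pcg K (G.schwarz K H N) f u₀ ℓ).sol

end SpatialNetwork

end

/-!
The subspaces of the additive Schwarz method split the functions that satisfy the boundary condition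
in a stable way, and the splitting has finite overlap. The abstract Schwarz theory turns these two
facts into bounds for the spectrum of the preconditioned operator, and the Chebyshev polynomials
turn the spectral bounds into the convergence rate.

*Stable decomposition* (`SpatialNetwork.exists_stable_decomposition`). Let `φ_a` be the nodal basis
functions of the mesh. For a mesh node outside `Γ`, the Poincaré inequality on the box of half-width
`2H` around it provides a constant `c_a`; for a mesh node in `Γ` the Friedrichs inequality applies,
because `Γ` has network nodes nearby, and `c_a = 0`. Put `v₀ = ∑ c_a φ_a` and `v_a = φ_a (v - v₀)`.
Since the `φ_a` sum to one, `v₀ x - v₀ y = ∑ (c_a - v x) (φ_a x - φ_a y)`, so that the Lipschitz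
bound `d / H` for `φ_a` estimates `|v₀|²_L` by `H⁻²` times the local deviations `|v - c_a|²_M`, and
the Poincaré inequality turns these into `μ² |v|²_L`
(`SpatialNetwork.IsPartitionOfUnity.stable_decomposition`). Decompositions only have to exist, so
`c_a` need not depend linearly on `v`. The result is the constant `C_d (1 + μ²)`, and
`1 ≤ C_d σ μ²`, by the choice of a coordinate function as test function if there are three elements
in a row (`SpatialNetwork.one_le_of_three_le`).

*Upper bound* (`SpatialNetwork.energy_sum_le`). At each node at most `7^d` patches overlap. The
operator `K` need not be local, so the overlap is used for the Laplacian `L`. The passage between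
`K` and `L` costs a factor `β / α`, here and in the stable decomposition, which is how `β² / α²`
enters `κ`.

*Convergence* (`additiveSchwarz_pcg_le`). In the energy inner product `(K u, v)` the preconditioned
operator is the sum of the orthogonal projections onto the subspaces. The errors of the conjugate
gradient method are optimal among all polynomials `q` of the operator with `q 0 = 1`
(`IsPCGSequence.norm_error_le_aeval`), in particular no worse than the transplanted Chebyshev
polynomial.

The existence of a Poincaré constant (`SpatialNetwork.exists_isPoincareConstant`) comes from the
connectivity assumption: inside the enlarged box two nodes are joined by a path with at most as many
edges as the network has nodes.
-/

/-! ### Chebyshev polynomials on an interval -/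

/-- The Chebyshev polynomial, transplanted to `[a, s²a]` and scaled to have value `1` at `0`. -/
theorem exists_chebyshev_polynomial (ℓ : ℕ) {a s : ℝ} (ha : 0 < a) (hs : 1 < s) :
    ∃ q : Polynomial ℝ, q.natDegree ≤ ℓ ∧ q.eval 0 = 1 ∧
      ∀ t ∈ Set.Icc a (s ^ 2 * a), |q.eval t| ≤ 2 * ((s - 1) / (s + 1)) ^ ℓ := by
  set τ : ℝ := (s + 1) / (s - 1) with hτ
  have hs1 : 0 < s - 1 := by linarith
  have hs2 : 0 < s ^ 2 - 1 := by nlinarith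
  have hτpos : 0 < τ := by positivity
  set x₀ : ℝ := (s ^ 2 + 1) / (s ^ 2 - 1) with hx₀
  -- `x₀ = (τ + τ⁻¹) / 2`, so that `T_ℓ(x₀) = (τ^ℓ + τ^(-ℓ)) / 2`
  have hcosh : x₀ = Real.cosh (Real.log τ) := by
    rw [Real.cosh_log hτpos, hx₀, hτ]
    have : s ^ 2 - 1 = (s - 1) * (s + 1) := by ring
    rw [this]
    have : s + 1 ≠ 0 := by positivity
    field_simp
    ring
  set D : ℝ := (Polynomial.Chebyshev.T ℝ (ℓ : ℤ)).eval x₀ with hD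
  have hDval : D = (τ ^ ℓ + (τ ^ ℓ)⁻¹) / 2 := by
    rw [hD, hcosh, Polynomial.Chebyshev.T_real_cosh, Int.cast_natCast, ← Real.log_pow,
      Real.cosh_log (by positivity)]
  have hDge : τ ^ ℓ / 2 ≤ D := by
    have : 0 < (τ ^ ℓ)⁻¹ := by positivity
    rw [hDval]; linarith
  have hDpos : 0 < D := lt_of_lt_of_le (by positivity) hDge
  refine ⟨Polynomial.C D⁻¹ * (Polynomial.Chebyshev.T ℝ (ℓ : ℤ)).comp
    (Polynomial.C x₀ - Polynomial.C (2 / ((s ^ 2 - 1) * a)) * Polynomial.X), ?_, ?_, ?_⟩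
  · refine (Polynomial.natDegree_C_mul_le _ _).trans ?_
    refine Polynomial.natDegree_comp_le.trans ?_
    have h1 : (Polynomial.Chebyshev.T ℝ (ℓ : ℤ)).natDegree = ℓ := by
      simp
    have h2 : (Polynomial.C x₀ - Polynomial.C (2 / ((s ^ 2 - 1) * a)) *
        Polynomial.X : Polynomial ℝ).natDegree ≤ 1 := by
      compute_degree
    rw [h1]
    nlinarith
  · simp only [Polynomial.eval_mul, Polynomial.eval_C, Polynomial.eval_comp, Polynomial.eval_sub,
      Polynomial.eval_X, mul_zero, sub_zero]
    rw [← hD]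
    exact inv_mul_cancel₀ hDpos.ne'
  · intro t ht
    simp only [Polynomial.eval_mul, Polynomial.eval_C, Polynomial.eval_comp, Polynomial.eval_sub,
      Polynomial.eval_X]
    have harg : |x₀ - 2 / ((s ^ 2 - 1) * a) * t| ≤ 1 := by
      have : x₀ - 2 / ((s ^ 2 - 1) * a) * t =
          ((s ^ 2 + 1) * a - 2 * t) / ((s ^ 2 - 1) * a) := by
        rw [hx₀]; field_simp
      rw [this, abs_le, le_div_iff₀ (by positivity), div_le_iff₀ (by positivity)]
      constructor <;> nlinarith [ht.1, ht.2]
    have hT := Polynomial.Chebyshev.abs_eval_T_real_le_one (ℓ : ℤ) harg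
    rw [abs_mul, abs_of_pos (inv_pos.2 hDpos)]
    calc D⁻¹ * _ ≤ D⁻¹ * 1 := by gcongr
      _ ≤ (τ ^ ℓ / 2)⁻¹ := by rw [mul_one]; exact inv_anti₀ (by positivity) hDge
      _ = 2 * ((s - 1) / (s + 1)) ^ ℓ := by
        rw [hτ, inv_div, ← inv_div (s + 1) (s - 1), inv_pow, div_eq_mul_inv]

/-! ### Polynomials of a symmetric operator -/

section Abstract

variable {E : Type*} [NormedAddCommGroup E] [InnerProductSpace ℝ E]

open scoped InnerProductSpace

/-- Spectral calculus estimate: a polynomial that is bounded by `M` on an interval which contains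
the spectrum of a symmetric operator has norm at most `M` at that operator. -/
theorem norm_aeval_apply_le [FiniteDimensional ℝ E] {P : E →ₗ[ℝ] E} (hP : P.IsSymmetric)
    {a b : ℝ} (hPa : ∀ x, a * ‖x‖ ^ 2 ≤ ⟪P x, x⟫_ℝ) (hPb : ∀ x, ⟪P x, x⟫_ℝ ≤ b * ‖x‖ ^ 2)
    (q : Polynomial ℝ) {M : ℝ} (hq : ∀ t ∈ Set.Icc a b, |q.eval t| ≤ M) (x : E) :
    ‖Polynomial.aeval P q x‖ ≤ M * ‖x‖ := by
  set B := hP.eigenvectorBasis rfl with hB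
  set ev := hP.eigenvalues rfl with hev
  have hPB : ∀ i, P (B i) = ev i • B i := fun i =>
    hP.apply_eigenvectorBasis rfl i
  have hmem : ∀ i, ev i ∈ Set.Icc a b := by
    intro i
    have h1 := hPa (B i)
    have h2 := hPb (B i)
    rw [hPB, inner_smul_left, real_inner_self_eq_norm_sq, B.norm_eq_one] at h1 h2
    simp at h1 h2
    exact ⟨h1, h2⟩
  have hqB : ∀ i, Polynomial.aeval P q (B i) = q.eval (ev i) • B i := by
    intro i
    refine Module.End.aeval_apply_of_hasEigenvector
      (Module.End.hasEigenvector_iff.2 ⟨Module.End.mem_eigenspace_iff.2 (hPB i), ?_⟩)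
    intro h0
    have := B.norm_eq_one i
    rw [h0, norm_zero] at this
    exact zero_ne_one this
  have hcoef : ∀ j, ⟪B j, Polynomial.aeval P q x⟫_ℝ = q.eval (ev j) * ⟪B j, x⟫_ℝ := by
    intro j
    have hx : Polynomial.aeval P q x =
        ∑ i, (⟪B i, x⟫_ℝ * q.eval (ev i)) • B i := by
      conv_lhs => rw [← B.sum_repr' x]
      simp [map_sum, hqB, smul_smul]
    rw [hx, inner_sum, Finset.sum_eq_single j]
    · rw [inner_smul_right, real_inner_self_eq_norm_sq, B.norm_eq_one]; ring
    · intro i _ hij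
      rw [inner_smul_right, B.inner_eq_zero hij.symm, mul_zero]
    · simp
  by_cases hM : 0 ≤ M
  · rw [← abs_of_nonneg (norm_nonneg (Polynomial.aeval P q x)),
      ← abs_of_nonneg (mul_nonneg hM (norm_nonneg x)), ← sq_le_sq, mul_pow,
      ← B.sum_sq_norm_inner_right, ← B.sum_sq_norm_inner_right, Finset.mul_sum]
    refine Finset.sum_le_sum fun i _ => ?_
    rw [hcoef, norm_mul, mul_pow, Real.norm_eq_abs]
    gcongr
    exact hq _ (hmem i)
  · -- a negative bound is only possible on the empty interval, and then `E` is trivial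
    have hzero : x = 0 := by
      have : ∀ i, ⟪B i, x⟫_ℝ = 0 := fun i =>
        absurd ((abs_nonneg _).trans (hq _ (hmem i))) hM
      rw [← B.sum_repr' x]
      simp [this]
    simp [hzero]

/-! ### The preconditioned conjugate gradient method -/

/-- The errors `e` and the search directions `p` of the preconditioned conjugate gradient method,
in the energy inner product; `P` is the preconditioned operator. Once the error is zero, `0 / 0 = 0`
keeps it at zero. -/
structure IsPCGSequence (P : E →ₗ[ℝ] E) (e p : ℕ → E) : Prop where
  zero : p 0 = P (e 0)
  error_succ : ∀ k, e (k + 1) = e k - (⟪P (e k), e k⟫_ℝ / ⟪p k, p k⟫_ℝ) • p k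
  dir_succ : ∀ k, p (k + 1) =
    P (e (k + 1)) + (⟪P (e (k + 1)), e (k + 1)⟫_ℝ / ⟪P (e k), e k⟫_ℝ) • p k

namespace IsPCGSequence

variable {P : E →ₗ[ℝ] E} {e p : ℕ → E}

theorem eq_zero_succ (h : IsPCGSequence P e p) {k : ℕ} (hk : e k = 0) : e (k + 1) = 0 := by
  rw [h.error_succ, hk]; simp

theorem eq_zero_of_le (h : IsPCGSequence P e p) {j k : ℕ} (hjk : j ≤ k) (hj : e j = 0) :
    e k = 0 := by
  induction hjk with
  | refl => exact hj
  | step _ ih => exact h.eq_zero_succ ih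

/-- The span of the first `k` search directions. -/
def dirSpan (p : ℕ → E) (k : ℕ) : Submodule ℝ E := Submodule.span ℝ (p '' Set.Iio k)

theorem dirSpan_mono {i j : ℕ} (hij : i ≤ j) : dirSpan p i ≤ dirSpan p j :=
  Submodule.span_mono (Set.image_mono (Set.Iio_subset_Iio hij))

theorem mem_dirSpan {i j : ℕ} (hij : i < j) : p i ∈ dirSpan p j :=
  Submodule.subset_span ⟨i, hij, rfl⟩

theorem inner_eq_zero_of_mem_dirSpan {k : ℕ} {y x : E} (hy : ∀ j < k, ⟪y, p j⟫_ℝ = 0)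
    (hx : x ∈ dirSpan p k) : ⟪y, x⟫_ℝ = 0 := by
  induction hx using Submodule.span_induction with
  | mem x hx => obtain ⟨j, hj, rfl⟩ := hx; exact hy j hj
  | zero => exact inner_zero_right _
  | add x z _ _ hx hz => rw [inner_add_right, hx, hz, add_zero]
  | smul c x _ hx => rw [inner_smul_right, hx, mul_zero]

theorem apply_error_mem (h : IsPCGSequence P e p) (k : ℕ) : P (e k) ∈ dirSpan p (k + 1) := by
  cases k with
  | zero => rw [← h.zero]; exact mem_dirSpan (Nat.lt_succ_self 0)
  | succ k =>
    rw [← sub_eq_iff_eq_add.2 (h.dir_succ k)]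
    exact Submodule.sub_mem _ (mem_dirSpan (Nat.lt_succ_self _))
      (Submodule.smul_mem _ _ (mem_dirSpan (by omega)))

theorem sub_error_mem (h : IsPCGSequence P e p) (k : ℕ) : e 0 - e k ∈ dirSpan p k := by
  induction k with
  | zero => simp
  | succ k ih =>
    rw [h.error_succ, ← sub_add]
    exact Submodule.add_mem _ (dirSpan_mono (Nat.le_succ k) ih)
      (Submodule.smul_mem _ _ (mem_dirSpan (Nat.lt_succ_self k)))

/-- As long as the error is orthogonal to the earlier search directions, the step length has its
textbook value. -/
theorem inner_error_dir (h : IsPCGSequence P e p) {k : ℕ}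
    (he : ∀ j < k, ⟪e k, p j⟫_ℝ = 0) : ⟪e k, p k⟫_ℝ = ⟪P (e k), e k⟫_ℝ := by
  cases k with
  | zero => rw [h.zero, real_inner_comm]
  | succ k =>
    rw [h.dir_succ, inner_add_right, inner_smul_right, he k (Nat.lt_succ_self k), mul_zero,
      add_zero, real_inner_comm]

/-- The error is orthogonal to the earlier search directions, and these are pairwise orthogonal, as
long as the solution is not reached. -/
theorem orthogonality (h : IsPCGSequence P e p) (hP : P.IsSymmetric)
    (hpos : ∀ x, x ≠ 0 → 0 < ⟪P x, x⟫_ℝ) (k : ℕ) (hne : e k ≠ 0) :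
    (∀ j < k, ⟪e k, p j⟫_ℝ = 0) ∧ (∀ j < k, ⟪p k, p j⟫_ℝ = 0) := by
  induction k using Nat.strong_induction_on with
  | _ k IH =>
  cases k with
  | zero => exact ⟨fun j hj => absurd hj (Nat.not_lt_zero j),
      fun j hj => absurd hj (Nat.not_lt_zero j)⟩
  | succ k =>
    have hnej : ∀ j ≤ k, e j ≠ 0 := fun j hj h0 => hne (h.eq_zero_of_le (by omega) h0)
    have hε : ∀ j ≤ k, 0 < ⟪P (e j), e j⟫_ℝ := fun j hj => hpos _ (hnej j hj)
    have hIH := fun j (hj : j ≤ k) => IH j (by omega) (hnej j hj)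
    have hpp : ∀ j ≤ k, 0 < ⟪p j, p j⟫_ℝ := by
      intro j hj
      refine real_inner_self_pos.2 fun h0 => ?_
      have := h.inner_error_dir (hIH j hj).1
      rw [h0, inner_zero_right] at this
      exact (hε j hj).ne this
    obtain ⟨he, hp⟩ := hIH k le_rfl
    have hek : ∀ j < k + 1, ⟪e (k + 1), p j⟫_ℝ = 0 := by
      intro j hj
      rw [h.error_succ, inner_sub_left, inner_smul_left]
      rcases Nat.lt_succ_iff_lt_or_eq.1 hj with hj | rfl
      · rw [he j hj, hp j hj]; simp
      · rw [h.inner_error_dir he, conj_trivial, div_mul_cancel₀ _ (hpp j le_rfl).ne', sub_self]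
    refine ⟨hek, fun j hj => ?_⟩
    -- `P (p j)` is a multiple of `P (e j) - P (e (j + 1))`
    have hPp : P (p j) = (⟪p j, p j⟫_ℝ / ⟪P (e j), e j⟫_ℝ) • (P (e j) - P (e (j + 1))) := by
      have h1 := hε j (by omega)
      have h2 := hpp j (by omega)
      rw [h.error_succ j, map_sub, sub_sub_cancel, map_smul, smul_smul,
        div_mul_div_cancel₀ h1.ne', div_self h2.ne', one_smul]
    rw [h.dir_succ, inner_add_left, inner_smul_left, hP, hPp, inner_smul_right, inner_sub_right,
      inner_eq_zero_of_mem_dirSpan hek (dirSpan_mono (by omega) (h.apply_error_mem j))]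
    rcases Nat.lt_succ_iff_lt_or_eq.1 hj with hj | rfl
    · rw [inner_eq_zero_of_mem_dirSpan hek (dirSpan_mono (by omega) (h.apply_error_mem (j + 1))),
        hp j hj]
      simp
    · rw [real_inner_comm (P (e (j + 1)))]
      simp only [conj_trivial]
      ring

/-- The search directions span the Krylov space, as long as the solution is not reached. -/
theorem pow_apply_mem (h : IsPCGSequence P e p) (hP : P.IsSymmetric)
    (hpos : ∀ x, x ≠ 0 → 0 < ⟪P x, x⟫_ℝ) (i : ℕ) (hne : e i ≠ 0) :
    (P ^ (i + 1)) (e 0) ∈ dirSpan p (i + 1) := by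
  induction i with
  | zero => simpa using h.apply_error_mem 0
  | succ i ih =>
    have hnei : e i ≠ 0 := fun h0 => hne (h.eq_zero_succ h0)
    rw [pow_succ', Module.End.mul_apply]
    have key : ∀ x ∈ dirSpan p (i + 1), P x ∈ dirSpan p (i + 1 + 1) := by
      intro x hx
      induction hx using Submodule.span_induction with
      | mem x hx =>
        obtain ⟨j, hj, rfl⟩ := hx
        have hj : j ≤ i := Nat.lt_succ_iff.1 hj
        have hnej : e j ≠ 0 := fun h0 => hnei (h.eq_zero_of_le hj h0)
        have hε := hpos _ hnej
        have hpp : ⟪p j, p j⟫_ℝ ≠ 0 := by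
          intro h0
          have := h.inner_error_dir (h.orthogonality hP hpos j hnej).1
          rw [inner_self_eq_zero.1 h0, inner_zero_right] at this
          exact hε.ne this
        have hPp : P (p j) =
            (⟪p j, p j⟫_ℝ / ⟪P (e j), e j⟫_ℝ) • (P (e j) - P (e (j + 1))) := by
          rw [h.error_succ j, map_sub, sub_sub_cancel, map_smul, smul_smul,
            div_mul_div_cancel₀ hε.ne', div_self hpp, one_smul]
        rw [hPp]
        exact Submodule.smul_mem _ _ (Submodule.sub_mem _
          (dirSpan_mono (by omega) (h.apply_error_mem j))
          (dirSpan_mono (by omega) (h.apply_error_mem (j + 1))))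
      | zero => simp
      | add x z _ _ hx hz => rw [map_add]; exact Submodule.add_mem _ hx hz
      | smul c x _ hx => rw [map_smul]; exact Submodule.smul_mem _ _ hx
    exact key _ (ih hnei)

/-- Optimality of the conjugate gradient iterates over all polynomials. -/
theorem norm_error_le_aeval (h : IsPCGSequence P e p) (hP : P.IsSymmetric)
    (hpos : ∀ x, x ≠ 0 → 0 < ⟪P x, x⟫_ℝ) {ℓ : ℕ} (q : Polynomial ℝ) (hdeg : q.natDegree ≤ ℓ)
    (hq0 : q.eval 0 = 1) : ‖e ℓ‖ ≤ ‖Polynomial.aeval P q (e 0)‖ := by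
  by_cases hne : e ℓ = 0
  · rw [hne, norm_zero]; exact norm_nonneg _
  have hmem : Polynomial.aeval P q (e 0) - e 0 ∈ dirSpan p ℓ := by
    rw [Polynomial.aeval_eq_sum_range' (Nat.lt_succ_of_le hdeg), Finset.sum_range_succ',
      Polynomial.coeff_zero_eq_eval_zero, hq0]
    simp only [pow_zero, one_smul, LinearMap.add_apply, Module.End.one_apply, add_sub_cancel_right,
      LinearMap.sum_apply, LinearMap.smul_apply]
    refine Submodule.sum_mem _ fun i hi => Submodule.smul_mem _ _ ?_
    have hi := Finset.mem_range.1 hi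
    exact dirSpan_mono hi (h.pow_apply_mem hP hpos i fun h0 => hne (h.eq_zero_of_le hi.le h0))
  have horth : ⟪e ℓ, Polynomial.aeval P q (e 0) - e ℓ⟫_ℝ = 0 := by
    refine inner_eq_zero_of_mem_dirSpan (h.orthogonality hP hpos ℓ hne).1 ?_
    rw [← sub_add_sub_cancel _ (e 0)]
    exact Submodule.add_mem _ hmem (h.sub_error_mem ℓ)
  have hsq : ‖e ℓ‖ * ‖e ℓ‖ ≤ ‖e ℓ‖ * ‖Polynomial.aeval P q (e 0)‖ := by
    rw [inner_sub_right, sub_eq_zero] at horth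
    rw [← real_inner_self_eq_norm_mul_norm, ← horth]
    exact real_inner_le_norm _ _
  exact le_of_mul_le_mul_left hsq (norm_pos_iff.2 hne)

/-- Convergence rate of the preconditioned conjugate gradient method if the spectrum of the
preconditioned operator lies in `[a, s²a]`. -/
theorem norm_error_le [FiniteDimensional ℝ E] (h : IsPCGSequence P e p) (hP : P.IsSymmetric)
    {a s : ℝ} (ha : 0 < a) (hs : 1 < s) (hPa : ∀ x, a * ‖x‖ ^ 2 ≤ ⟪P x, x⟫_ℝ)
    (hPb : ∀ x, ⟪P x, x⟫_ℝ ≤ s ^ 2 * a * ‖x‖ ^ 2) (ℓ : ℕ) :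
    ‖e ℓ‖ ≤ 2 * ((s - 1) / (s + 1)) ^ ℓ * ‖e 0‖ := by
  obtain ⟨q, hdeg, hq0, hq⟩ := exists_chebyshev_polynomial ℓ ha hs
  refine (h.norm_error_le_aeval hP (fun x hx => lt_of_lt_of_le ?_ (hPa x)) q hdeg hq0).trans
    (norm_aeval_apply_le hP hPa hPb q hq _)
  have := norm_pos_iff.2 hx
  positivity

end IsPCGSequence

/-! ### Additive Schwarz operators -/

/-- The sum of the orthogonal projections onto a finite family of subspaces. -/
noncomputable def schwarzOperator [FiniteDimensional ℝ E] {ι : Type*} [Fintype ι]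
    (W : ι → Submodule ℝ E) : E →ₗ[ℝ] E :=
  ∑ j, ((W j).starProjection : E →ₗ[ℝ] E)

variable [FiniteDimensional ℝ E] {ι : Type*} [Fintype ι] {W : ι → Submodule ℝ E}

theorem schwarzOperator_apply (x : E) :
    schwarzOperator W x = ∑ j, (W j).starProjection x := by
  simp [schwarzOperator]

theorem inner_starProjection_self (U : Submodule ℝ E) (x : E) :
    ⟪U.starProjection x, x⟫_ℝ = ‖U.starProjection x‖ ^ 2 := by
  conv_lhs => rw [← U.starProjection_eq_self_iff.2 (U.starProjection_apply_mem x)]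
  rw [U.inner_starProjection_left_eq_right, real_inner_self_eq_norm_sq]

theorem inner_schwarzOperator_self (x : E) :
    ⟪schwarzOperator W x, x⟫_ℝ = ∑ j, ‖(W j).starProjection x‖ ^ 2 := by
  simp only [schwarzOperator_apply, sum_inner, inner_starProjection_self]

theorem schwarzOperator_isSymmetric : (schwarzOperator W).IsSymmetric := by
  intro x y
  simp only [schwarzOperator_apply, sum_inner, inner_sum]
  exact Finset.sum_congr rfl fun j _ => (W j).inner_starProjection_left_eq_right x y

/-- Upper bound from a strengthened triangle inequality. -/
theorem inner_schwarzOperator_le {Λ : ℝ} (hΛ : 0 ≤ Λ)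
    (hW : ∀ w : ι → E, (∀ j, w j ∈ W j) → ‖∑ j, w j‖ ^ 2 ≤ Λ * ∑ j, ‖w j‖ ^ 2) (x : E) :
    ⟪schwarzOperator W x, x⟫_ℝ ≤ Λ * ‖x‖ ^ 2 := by
  have h1 := hW (fun j => (W j).starProjection x) fun j => (W j).starProjection_apply_mem x
  rw [← schwarzOperator_apply, ← inner_schwarzOperator_self] at h1
  have h2 := real_inner_le_norm (schwarzOperator W x) x
  have h3 : ‖schwarzOperator W x‖ * ‖schwarzOperator W x‖ ≤
      ‖schwarzOperator W x‖ * (Λ * ‖x‖) := by nlinarith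
  rcases (norm_nonneg (schwarzOperator W x)).eq_or_lt with h0 | h0
  · rw [← h0, zero_mul] at h2
    exact h2.trans (by positivity)
  · have := le_of_mul_le_mul_left h3 h0
    nlinarith [norm_nonneg x]

/-- Lower bound from a stable decomposition (Lions' lemma). -/
theorem le_inner_schwarzOperator {C₀ : ℝ} (hC : 0 < C₀)
    (hW : ∀ x : E, ∃ w : ι → E, (∀ j, w j ∈ W j) ∧ ∑ j, w j = x ∧
      ∑ j, ‖w j‖ ^ 2 ≤ C₀ * ‖x‖ ^ 2) (x : E) :
    C₀⁻¹ * ‖x‖ ^ 2 ≤ ⟪schwarzOperator W x, x⟫_ℝ := by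
  obtain ⟨w, hw, hsum, hle⟩ := hW x
  have hx : ‖x‖ ^ 2 = ∑ j, ⟪(W j).starProjection x, w j⟫_ℝ := by
    rw [← real_inner_self_eq_norm_sq]
    conv_lhs => rw [← hsum, inner_sum, hsum]
    refine Finset.sum_congr rfl fun j _ => ?_
    rw [(W j).inner_starProjection_left_eq_right, (W j).starProjection_eq_self_iff.2 (hw j)]
  rw [inner_schwarzOperator_self]
  set A := ∑ j, ‖(W j).starProjection x‖ ^ 2 with hA
  -- Young's inequality with the weight `C₀`
  have hle2 : ‖x‖ ^ 2 ≤ C₀ / 2 * A + (2 * C₀)⁻¹ * ∑ j, ‖w j‖ ^ 2 := by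
    rw [hx, hA, Finset.mul_sum, Finset.mul_sum, ← Finset.sum_add_distrib]
    refine Finset.sum_le_sum fun j _ => (real_inner_le_norm _ _).trans ?_
    have h := sq_nonneg (C₀ * ‖(W j).starProjection x‖ - ‖w j‖)
    have h' : C₀ / 2 * ‖(W j).starProjection x‖ ^ 2 + (2 * C₀)⁻¹ * ‖w j‖ ^ 2 -
        ‖(W j).starProjection x‖ * ‖w j‖ =
        (2 * C₀)⁻¹ * (C₀ * ‖(W j).starProjection x‖ - ‖w j‖) ^ 2 := by
      field_simp
      ring
    have : 0 ≤ (2 * C₀)⁻¹ * (C₀ * ‖(W j).starProjection x‖ - ‖w j‖) ^ 2 := by positivity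
    linarith
  have h3 : (2 * C₀)⁻¹ * ∑ j, ‖w j‖ ^ 2 ≤ ‖x‖ ^ 2 / 2 := by
    calc (2 * C₀)⁻¹ * ∑ j, ‖w j‖ ^ 2 ≤ (2 * C₀)⁻¹ * (C₀ * ‖x‖ ^ 2) := by gcongr
      _ = ‖x‖ ^ 2 / 2 := by field_simp
  rw [inv_mul_le_iff₀ hC]
  linarith

end Abstract

/-! ### The hat function -/

/-- The one-dimensional hat function. -/
noncomputable def hat (t : ℝ) : ℝ := max 0 (1 - |t|)

theorem hat_nonneg (t : ℝ) : 0 ≤ hat t := le_max_left _ _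

theorem hat_le_one (t : ℝ) : hat t ≤ 1 := by
  unfold hat
  exact max_le zero_le_one (by linarith [abs_nonneg t])

theorem abs_lt_one_of_hat_ne_zero {t : ℝ} (h : hat t ≠ 0) : |t| < 1 := by
  by_contra hc
  exact h (max_eq_left (by linarith))

theorem abs_hat_sub_hat_le (s t : ℝ) : |hat s - hat t| ≤ |s - t| := by
  unfold hat
  refine (abs_max_sub_max_le_max _ _ _ _).trans ?_
  rw [sub_self, abs_zero, sub_sub_sub_cancel_left, abs_sub_comm s]
  exact max_le (abs_nonneg _) (abs_abs_sub_abs_le _ _)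

theorem continuous_hat : Continuous hat := by
  unfold hat
  fun_prop

/-- The integer translates of the hat function up to `N` form a partition of unity on `[0, N]`. -/
theorem sum_hat_eq_one {N : ℕ} {t : ℝ} (h0 : 0 ≤ t) (hN : t ≤ N) :
    ∑ k : Fin (N + 1), hat (t - (k : ℕ)) = 1 := by
  have key : ∀ n : ℕ, ∑ k ∈ Finset.range (n + 1), hat (t - (k : ℕ)) =
      min 1 (max 0 (n + 1 - t)) := by
    intro n
    induction n with
    | zero =>
      simp only [zero_add, Finset.range_one, Finset.sum_singleton, Nat.cast_zero, sub_zero, hat,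
        abs_of_nonneg h0]
      rw [min_eq_right (max_le zero_le_one (by linarith))]
    | succ n ih =>
      rw [Finset.sum_range_succ, ih, hat]
      push_cast
      rcases le_total t n with h1 | h1
      · rw [abs_of_nonpos (by linarith), max_eq_right (by linarith : (0 : ℝ) ≤ n + 1 - t),
          min_eq_left (by linarith), max_eq_left (by linarith), max_eq_right (by linarith),
          min_eq_left (by linarith), add_zero]
      rcases le_total t (n + 1) with h2 | h2
      · rw [abs_of_nonpos (by linarith), max_eq_right (by linarith : (0 : ℝ) ≤ n + 1 - t),
          min_eq_right (by linarith), max_eq_right (by linarith), max_eq_right (by linarith),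
          min_eq_left (by linarith)]
        ring
      · rw [abs_of_nonneg (by linarith), max_eq_left (by linarith : (n : ℝ) + 1 - t ≤ 0),
          min_eq_right (by linarith), zero_add,
          min_eq_right (max_le zero_le_one (by linarith))]
        congr 1
        ring
  rw [Fin.sum_univ_eq_sum_range (fun k => hat (t - (k : ℕ))), key, max_eq_right (by linarith),
    min_eq_left (by linarith)]

/-- The hat function is affine between consecutive integers. -/
theorem exists_affine_hat (m k : ℤ) :
    ∃ p q : ℝ, ∀ t : ℝ, (m : ℝ) - 1 ≤ t → t ≤ m → hat (t - k) = p + q * t := by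
  rcases lt_trichotomy k (m - 1) with h | h | h
  · refine ⟨0, 0, fun t h1 h2 => ?_⟩
    have h : (k : ℝ) ≤ m - 2 := by exact_mod_cast (by omega : k ≤ m - 2)
    rw [hat, abs_of_nonneg (by linarith), max_eq_left (by linarith)]
    ring
  · refine ⟨1 + k, -1, fun t h1 h2 => ?_⟩
    have h : (k : ℝ) = m - 1 := by exact_mod_cast h
    rw [hat, abs_of_nonneg (by linarith), max_eq_right (by linarith)]
    ring
  · rcases eq_or_lt_of_le (show m ≤ k by omega) with h' | h'
    · refine ⟨1 - k, 1, fun t h1 h2 => ?_⟩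
      have h : (m : ℝ) = k := by exact_mod_cast h'
      rw [hat, abs_of_nonpos (by linarith), max_eq_right (by linarith)]
      ring
    · refine ⟨0, 0, fun t h1 h2 => ?_⟩
      have h : (m : ℝ) + 1 ≤ k := by exact_mod_cast h'
      rw [hat, abs_of_nonpos (by linarith), max_eq_left (by linarith)]
      ring

theorem abs_prod_sub_prod_le {ι : Type*} (s : Finset ι) (f g : ι → ℝ)
    (hf : ∀ i, 0 ≤ f i ∧ f i ≤ 1) (hg : ∀ i, 0 ≤ g i ∧ g i ≤ 1) :
    |∏ i ∈ s, f i - ∏ i ∈ s, g i| ≤ ∑ i ∈ s, |f i - g i| := by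
  classical
  induction s using Finset.induction_on with
  | empty => simp
  | insert i s hi ih =>
    rw [Finset.prod_insert hi, Finset.prod_insert hi, Finset.sum_insert hi]
    have hP0 : 0 ≤ ∏ j ∈ s, f j := Finset.prod_nonneg fun j _ => (hf j).1
    have hP1 : ∏ j ∈ s, f j ≤ 1 := Finset.prod_le_one (fun j _ => (hf j).1) fun j _ => (hf j).2
    calc |f i * ∏ j ∈ s, f j - g i * ∏ j ∈ s, g j|
        = |(f i - g i) * ∏ j ∈ s, f j + g i * (∏ j ∈ s, f j - ∏ j ∈ s, g j)| := by ring_nf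
      _ ≤ |f i - g i| * |∏ j ∈ s, f j| + |g i| * |∏ j ∈ s, f j - ∏ j ∈ s, g j| := by
          rw [← abs_mul, ← abs_mul]; exact abs_add_le _ _
      _ ≤ |f i - g i| * 1 + 1 * ∑ j ∈ s, |f j - g j| := by
          rw [abs_of_nonneg hP0, abs_of_nonneg (hg i).1]
          gcongr
          exact (hg i).2
      _ = _ := by ring

/-! ### Nodal basis functions of the mesh -/

section NodalBasis

variable {d : ℕ} {N : Fin d → ℕ}

/-- The nodal basis function of the mesh node with multi-index `a`: a product of hat functions. -/
noncomputable def nodalBasis (H : ℝ) (a : (i : Fin d) → Fin (N i + 1)) (z : Pt d) : ℝ :=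
  ∏ i, hat (z i / H - (a i : ℕ))

theorem nodalBasis_nonneg (H : ℝ) (a : (i : Fin d) → Fin (N i + 1)) (z : Pt d) :
    0 ≤ nodalBasis H a z :=
  Finset.prod_nonneg fun _ _ => hat_nonneg _

theorem continuous_nodalBasis (H : ℝ) (a : (i : Fin d) → Fin (N i + 1)) :
    Continuous (nodalBasis H a) := by
  unfold nodalBasis
  refine continuous_finsetProd _ fun i _ => continuous_hat.comp ?_
  fun_prop

theorem abs_lt_of_nodalBasis_ne_zero {H : ℝ} (hH : 0 < H) {a : (i : Fin d) → Fin (N i + 1)}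
    {z : Pt d} (h : nodalBasis H a z ≠ 0) (i : Fin d) : |z i - H * (a i : ℕ)| < H := by
  have h1 := abs_lt_one_of_hat_ne_zero (Finset.prod_ne_zero_iff.1 h i (Finset.mem_univ i))
  have h2 : z i - H * (a i : ℕ) = H * (z i / H - (a i : ℕ)) := by field_simp
  rw [h2, abs_mul, abs_of_pos hH]
  nlinarith

theorem abs_nodalBasis_sub_le {H : ℝ} (hH : 0 < H) (a : (i : Fin d) → Fin (N i + 1))
    (x y : Pt d) : |nodalBasis H a x - nodalBasis H a y| ≤ d / H * ‖x - y‖ := by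
  refine (abs_prod_sub_prod_le _ _ _ (fun _ => ⟨hat_nonneg _, hat_le_one _⟩)
    fun _ => ⟨hat_nonneg _, hat_le_one _⟩).trans ?_
  have : ∀ i ∈ Finset.univ, |hat (x i / H - (a i : ℕ)) - hat (y i / H - (a i : ℕ))| ≤
      ‖x - y‖ / H := by
    intro i _
    refine (abs_hat_sub_hat_le _ _).trans ?_
    rw [sub_sub_sub_cancel_right, ← sub_div, abs_div, abs_of_pos hH]
    gcongr
    exact PiLp.norm_apply_le (x - y) i
  refine (Finset.sum_le_sum this).trans (le_of_eq ?_)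
  rw [Finset.sum_const, Finset.card_univ, Fintype.card_fin, nsmul_eq_mul]
  ring

theorem sum_nodalBasis_eq_one {H : ℝ} (hH : 0 < H) {z : Pt d}
    (hz : ∀ i, 0 ≤ z i ∧ z i ≤ N i * H) :
    ∑ a : (i : Fin d) → Fin (N i + 1), nodalBasis H a z = 1 := by
  unfold nodalBasis
  rw [← Fintype.piFinset_univ,
    ← Finset.prod_univ_sum (fun _ => Finset.univ)
      (fun i (k : Fin (N i + 1)) => hat (z i / H - (k : ℕ)))]
  refine Finset.prod_eq_one fun i _ => sum_hat_eq_one ?_ ?_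
  · exact div_nonneg (hz i).1 hH.le
  · rw [div_le_iff₀ hH]; exact (hz i).2

open Classical in
/-- Every point is close to a bounded number of mesh nodes: in each direction at most seven multiples
of `H` have distance at most `3H`. -/
theorem card_near_le {H : ℝ} (hH : 0 < H) (z : Pt d) :
    ((Finset.univ.filter fun a : (i : Fin d) → Fin (N i + 1) =>
      ∀ i, |z i - H * (a i : ℕ)| ≤ 3 * H).card : ℝ) ≤ 7 ^ d := by
  have hsub : (Finset.univ.filter fun a : (i : Fin d) → Fin (N i + 1) =>
      ∀ i, |z i - H * (a i : ℕ)| ≤ 3 * H) ⊆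
      Fintype.piFinset fun i => Finset.univ.filter fun k : Fin (N i + 1) =>
        |z i - H * (k : ℕ)| ≤ 3 * H := by
    intro a ha
    simpa using ha
  have hone : ∀ i, (Finset.univ.filter fun k : Fin (N i + 1) =>
      |z i - H * (k : ℕ)| ≤ 3 * H).card ≤ 7 := by
    intro i
    have hinj : Set.InjOn (fun k : Fin (N i + 1) => ((k : ℕ) : ℤ))
        (Finset.univ.filter fun k : Fin (N i + 1) => |z i - H * (k : ℕ)| ≤ 3 * H) := by
      intro k _ k' _ h
      simpa [Fin.ext_iff] using h
    have hmaps : ∀ k ∈ (Finset.univ.filter fun k : Fin (N i + 1) =>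
        |z i - H * (k : ℕ)| ≤ 3 * H),
        ((k : ℕ) : ℤ) ∈ Finset.Icc (⌊z i / H⌋ - 3) (⌊z i / H⌋ + 3) := by
      intro k hk
      have hk := abs_le.1 (Finset.mem_filter.1 hk).2
      have hz : z i = H * (z i / H) := by field_simp
      have h1 : z i / H - 3 ≤ (k : ℕ) := by
        by_contra hc
        push Not at hc
        nlinarith
      have h2 : ((k : ℕ) : ℝ) ≤ z i / H + 3 := by
        by_contra hc
        push Not at hc
        nlinarith
      have h3 : ((k : ℕ) : ℤ) ≤ ⌊z i / H + 3⌋ := Int.le_floor.2 (by exact_mod_cast h2)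
      have h4 : ⌊z i / H - 3⌋ ≤ ((k : ℕ) : ℤ) :=
        Int.floor_le_iff.2 (by push_cast; linarith)
      have h5 : ⌊z i / H + 3⌋ = ⌊z i / H⌋ + 3 := by exact_mod_cast Int.floor_add_ofNat (z i / H) 3
      have h6 : ⌊z i / H - 3⌋ = ⌊z i / H⌋ - 3 := by exact_mod_cast Int.floor_sub_ofNat (z i / H) 3
      rw [Finset.mem_Icc]
      omega
    have := Finset.card_le_card_of_injOn _ hmaps hinj
    rw [Int.card_Icc] at this
    omega
  have h := Finset.card_le_card hsub
  rw [Fintype.card_piFinset] at h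
  have h2 : ∏ i, (Finset.univ.filter fun k : Fin (N i + 1) =>
      |z i - H * (k : ℕ)| ≤ 3 * H).card ≤ ∏ _i : Fin d, 7 :=
    Finset.prod_le_prod' fun i _ => hone i
  rw [Finset.prod_const, Finset.card_univ, Fintype.card_fin] at h2
  exact_mod_cast h.trans h2

end NodalBasis

namespace SpatialNetwork

variable {d : ℕ} (G : SpatialNetwork d) {H : ℝ} {N : Fin d → ℕ}

/-! ### Elements and patches -/

/-- The centre of the element with multi-index `k`. -/
noncomputable def cellCenter (H : ℝ) (k : Fin d → ℕ) : Pt d :=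
  WithLp.toLp 2 fun i => H * ((k i : ℝ) + 1 / 2)

@[simp] theorem cellCenter_apply (k : Fin d → ℕ) (i : Fin d) :
    cellCenter H k i = H * ((k i : ℝ) + 1 / 2) := rfl

@[simp] theorem meshNode_apply (a : (i : Fin d) → Fin (N i + 1)) (i : Fin d) :
    meshNode H a i = H * (a i : ℕ) := rfl

theorem isCenter_cellCenter (hH : 0 < H) (hside : ∀ i, G.side i = N i * H) {k : Fin d → ℕ}
    (hk : ∀ i, k i < N i) : G.IsCenter H (cellCenter H k) := by
  refine ⟨fun i => ⟨?_, ?_⟩, fun i => ⟨k i + 1, ?_⟩⟩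
  · simp only [cellCenter_apply]; positivity
  · have : (k i : ℝ) + 1 ≤ N i := by exact_mod_cast hk i
    rw [hside, cellCenter_apply]
    nlinarith
  · rw [cellCenter_apply, ← mul_assoc, inv_mul_cancel₀ hH.ne']
    push_cast; ring

theorem boxInside_cellCenter (hH : 0 < H) (hside : ∀ i, G.side i = N i * H) {k : Fin d → ℕ}
    (hk : ∀ i, k i < N i) : G.BoxInside (H / 2) (cellCenter H k) := by
  intro i
  have : (k i : ℝ) + 1 ≤ N i := by exact_mod_cast hk i
  rw [hside, cellCenter_apply]
  constructor
  · have : 0 ≤ H * k i := by positivity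
    linarith
  · nlinarith

theorem box_cellCenter_bounds {k : Fin d → ℕ} {z : Pt d}
    (hz : z ∈ G.box (H / 2) (cellCenter H k)) (i : Fin d) :
    H * k i ≤ z i ∧ (z i < H * (k i + 1) ∨ H * (k i + 1) = G.side i ∧ z i = H * (k i + 1)) := by
  have h := hz.2 i
  rw [cellCenter_apply] at h
  have e1 : H * ((k i : ℝ) + 1 / 2) - H / 2 = H * k i := by ring
  have e2 : H * ((k i : ℝ) + 1 / 2) + H / 2 = H * (k i + 1) := by ring
  rwa [e1, e2] at h

theorem exists_cell (hH : 0 < H) (hside : ∀ i, G.side i = N i * H) {z : Pt d} (hz : z ∈ G.Ω) :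
    ∃ k : Fin d → ℕ, (∀ i, k i < N i) ∧ z ∈ G.box (H / 2) (cellCenter H k) := by
  have key : ∀ i, ∃ k : ℕ, k < N i ∧ H * k ≤ z i ∧
      (z i < H * (k + 1) ∨ (H * (k + 1) = G.side i ∧ z i = H * (k + 1))) := by
    intro i
    obtain ⟨h0, h1⟩ := hz i
    have hpos := G.side_pos i
    rw [hside] at h1 hpos
    have hNpos : 0 < N i := by
      by_contra hc
      have : N i = 0 := by omega
      simp [this] at hpos
    have hq : 0 ≤ z i / H := div_nonneg h0 hH.le
    have hzH : z i = H * (z i / H) := by field_simp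
    rcases h1.lt_or_eq with h1 | h1
    · refine ⟨⌊z i / H⌋₊, ?_, ?_, Or.inl ?_⟩
      · rw [Nat.floor_lt hq, div_lt_iff₀ hH]; exact h1
      · rw [hzH]
        have := Nat.floor_le hq
        rw [← hzH]
        nlinarith
      · have := Nat.lt_floor_add_one (z i / H)
        nlinarith
    · have hc : ((N i - 1 : ℕ) : ℝ) = N i - 1 := by
        rw [Nat.cast_sub (by omega)]; simp
      refine ⟨N i - 1, by omega, ?_, Or.inr ⟨?_, ?_⟩⟩
      · rw [hc, h1]; nlinarith
      · rw [hc, hside]; ring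
      · rw [hc, h1]; ring
  choose k hk using key
  refine ⟨k, fun i => (hk i).1, hz, fun i => ?_⟩
  rw [cellCenter_apply]
  have e1 : H * ((k i : ℝ) + 1 / 2) - H / 2 = H * k i := by ring
  have e2 : H * ((k i : ℝ) + 1 / 2) + H / 2 = H * (k i + 1) := by ring
  rw [e1, e2]
  exact (hk i).2

theorem box_subset_closedBox (R : ℝ) (x : Pt d) :
    G.box R x ⊆ {z | ∀ i, |z i - x i| ≤ R} := by
  intro z hz i
  obtain ⟨h1, h2⟩ := hz.2 i
  rw [abs_le]
  rcases h2 with h2 | ⟨-, h2⟩ <;> constructor <;> linarith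

theorem isClosed_closedBox (R : ℝ) (x : Pt d) : IsClosed {z : Pt d | ∀ i, |z i - x i| ≤ R} := by
  rw [Set.ofPred_forall]
  exact isClosed_iInter fun i => isClosed_le (by fun_prop) continuous_const

theorem closure_box_subset (R : ℝ) (x : Pt d) :
    closure (G.box R x) ⊆ {z | ∀ i, |z i - x i| ≤ R} :=
  closure_minimal (G.box_subset_closedBox R x) (isClosed_closedBox R x)

/-- The closure of a box inside the domain is the closed box. -/
theorem mem_closure_box {R : ℝ} (hR : 0 < R) {x : Pt d} (hx : G.BoxInside R x) {y : Pt d}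
    (hy : ∀ i, |y i - x i| ≤ R) : y ∈ closure (G.box R x) := by
  have hlim : Filter.Tendsto (fun t : ℝ => y + t • (x - y)) (nhdsWithin 0 (Set.Ioi 0))
      (nhds y) := by
    have : Continuous fun t : ℝ => y + t • (x - y) := by fun_prop
    have h0 := this.tendsto 0
    simp only [zero_smul, add_zero] at h0
    exact h0.mono_left nhdsWithin_le_nhds
  refine mem_closure_of_tendsto hlim ?_
  filter_upwards [Ioo_mem_nhdsGT (show (0 : ℝ) < 1 by norm_num)] with t ht
  obtain ⟨ht0, ht1⟩ := ht
  have hcoord : ∀ i, x i - R ≤ (y + t • (x - y)) i ∧ (y + t • (x - y)) i < x i + R := by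
    intro i
    have e : (y + t • (x - y)) i = x i + (1 - t) * (y i - x i) := by
      simp only [PiLp.add_apply, PiLp.smul_apply, PiLp.sub_apply, smul_eq_mul]; ring
    rw [e]
    obtain ⟨h1, h2⟩ := abs_le.1 (hy i)
    constructor <;> nlinarith
  refine ⟨fun i => ?_, fun i => ⟨(hcoord i).1, Or.inl (hcoord i).2⟩⟩
  have := hx i
  have := hcoord i
  constructor <;> linarith

theorem abs_le_of_mem_patch {a : (i : Fin d) → Fin (N i + 1)} {z : Pt d}
    (hz : z ∈ G.patch H {meshNode H a}) (i : Fin d) : |z i - H * (a i : ℕ)| ≤ H := by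
  obtain ⟨-, T, ⟨x, -, rfl⟩, hzT, y, hyT, hy⟩ := hz
  rw [closure_singleton, Set.mem_singleton_iff] at hy
  subst hy
  have h1 := abs_le.1 (G.closure_box_subset _ _ hyT i)
  have h2 := abs_le.1 (G.box_subset_closedBox _ _ hzT i)
  rw [meshNode_apply] at h1
  rw [abs_le]
  constructor <;> linarith

theorem mem_patch_of_nodalBasis_ne_zero (hH : 0 < H) (hside : ∀ i, G.side i = N i * H)
    {a : (i : Fin d) → Fin (N i + 1)} {z : Pt d} (hz : z ∈ G.Ω) (h : nodalBasis H a z ≠ 0) :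
    z ∈ G.patch H {meshNode H a} := by
  obtain ⟨k, hk, hzk⟩ := G.exists_cell hH hside hz
  refine ⟨hz, _, ⟨_, G.isCenter_cellCenter hH hside hk, rfl⟩, hzk, meshNode H a, ?_, ?_⟩
  · refine G.mem_closure_box (by positivity) (G.boxInside_cellCenter hH hside hk) fun i => ?_
    obtain ⟨h1, h2⟩ := G.box_cellCenter_bounds hzk i
    obtain ⟨h3, h4⟩ := abs_lt.1 (abs_lt_of_nodalBasis_ne_zero hH h i)
    have h5 : k i ≤ (a i : ℕ) := by
      have : H * (k i : ℝ) < H * ((a i : ℕ) + 1) := by linarith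
      have := lt_of_mul_lt_mul_left this hH.le
      have : k i < (a i : ℕ) + 1 := by exact_mod_cast this
      omega
    have h6 : (a i : ℕ) ≤ k i + 1 := by
      rcases h2 with h2 | ⟨h2, -⟩
      · have : H * ((a i : ℕ) : ℝ) < H * (k i + 2) := by linarith
        have := lt_of_mul_lt_mul_left this hH.le
        have : (a i : ℕ) < k i + 2 := by exact_mod_cast this
        omega
      · have h7 : H * ((k i : ℝ) + 1) = H * N i := by rw [h2, hside]; ring
        have h8 := mul_left_cancel₀ hH.ne' h7
        have : k i + 1 = N i := by exact_mod_cast h8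
        have := (a i).is_lt
        omega
    have h5' : (k i : ℝ) ≤ (a i : ℕ) := by exact_mod_cast h5
    have h6' : ((a i : ℕ) : ℝ) ≤ k i + 1 := by exact_mod_cast h6
    rw [meshNode_apply, cellCenter_apply, abs_le]
    constructor <;> nlinarith
  · rw [closure_singleton]; rfl

/-! ### Nodal basis functions as finite element functions -/

theorem nodalBasis_multilinear (hH : 0 < H) (a : (i : Fin d) → Fin (N i + 1)) {T : Set (Pt d)}
    (hT : T ∈ G.mesh H) :
    ∃ c : Finset (Fin d) → ℝ, ∀ z ∈ T, nodalBasis H a z = ∑ S, c S * ∏ i ∈ S, z i := by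
  obtain ⟨x, ⟨-, hx⟩, rfl⟩ := hT
  choose m hm using hx
  choose p q hpq using fun i => exists_affine_hat (m i) ((a i : ℕ) : ℤ)
  refine ⟨fun S => (∏ i ∈ S, q i / H) * ∏ i ∈ Finset.univ \ S, p i, fun z hz => ?_⟩
  have hz' := G.box_subset_closedBox _ _ hz
  have hfac : ∀ i, hat (z i / H - (a i : ℕ)) = q i / H * z i + p i := by
    intro i
    obtain ⟨h1, h2⟩ := abs_le.1 (hz' i)
    have hxi : x i = H * (m i - 1 / 2) := by
      rw [← hm i]; field_simp; ring
    have := hpq i (z i / H) ?_ ?_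
    · rw [Int.cast_natCast] at this
      rw [this]; ring
    · rw [le_div_iff₀ hH]; nlinarith
    · rw [div_le_iff₀ hH]; nlinarith
  unfold nodalBasis
  rw [Finset.prod_congr rfl fun i _ => hfac i, Finset.prod_add, Finset.powerset_univ]
  refine Finset.sum_congr rfl fun S _ => ?_
  rw [Finset.prod_mul_distrib]
  ring

/-- A face that meets the support of a nodal basis function contains the mesh node. -/
theorem meshNode_mem_face (hH : 0 < H) (a : (i : Fin d) → Fin (N i + 1)) {F : Set (Pt d)}
    (hF : G.IsElementFace H F) {z : Pt d} (hz : z ∈ F) (h : nodalBasis H a z ≠ 0) :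
    meshNode H a ∈ F := by
  obtain ⟨x, ⟨-, hx⟩, i, s, hs, rfl⟩ := hF
  choose m hm using hx
  have hxi : ∀ j, x j = H * (m j - 1 / 2) := by
    intro j
    rw [← hm j]; field_simp; ring
  have habs := abs_lt_of_nodalBasis_ne_zero hH h
  refine ⟨?_, fun j hj => ?_⟩
  · obtain ⟨M, hM⟩ : ∃ M : ℤ, x i + s * (H / 2) = H * M := by
      rcases hs with rfl | rfl
      · exact ⟨m i, by rw [hxi]; ring⟩
      · exact ⟨m i - 1, by rw [hxi]; push_cast; ring⟩
    have h1 := abs_lt.1 (habs i)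
    rw [hz.1, hM] at h1
    rw [hM, meshNode_apply]
    have h2 : H * (M : ℝ) < H * ((a i : ℕ) + 1) := by linarith
    have h3 : H * ((a i : ℕ) : ℝ) < H * (M + 1) := by linarith
    have h2 := lt_of_mul_lt_mul_left h2 hH.le
    have h3 := lt_of_mul_lt_mul_left h3 hH.le
    have h2 : M < ((a i : ℕ) : ℤ) + 1 := by exact_mod_cast h2
    have h3 : ((a i : ℕ) : ℤ) < M + 1 := by exact_mod_cast h3
    have : ((a i : ℕ) : ℤ) = M := by omega
    rw [← this, Int.cast_natCast]
  · obtain ⟨h1, h2⟩ := abs_le.1 (hz.2 j hj)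
    obtain ⟨h3, h4⟩ := abs_lt.1 (habs j)
    rw [hxi] at h1 h2 ⊢
    have h5 : H * ((m j : ℝ) - 1) < H * ((a j : ℕ) + 1) := by linarith
    have h6 : H * ((a j : ℕ) : ℝ) < H * (m j + 1) := by linarith
    have h5 := lt_of_mul_lt_mul_left h5 hH.le
    have h6 := lt_of_mul_lt_mul_left h6 hH.le
    have h5 : m j - 1 < ((a j : ℕ) : ℤ) + 1 := by exact_mod_cast h5
    have h6 : ((a j : ℕ) : ℤ) < m j + 1 := by exact_mod_cast h6
    have h5 : m j - 1 ≤ ((a j : ℕ) : ℤ) := by omega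
    have h6 : ((a j : ℕ) : ℤ) ≤ m j := by omega
    have h5 : (m j : ℝ) - 1 ≤ (a j : ℕ) := by exact_mod_cast h5
    have h6 : ((a j : ℕ) : ℝ) ≤ m j := by exact_mod_cast h6
    rw [meshNode_apply, abs_le]
    constructor <;> nlinarith

theorem nodalBasis_mem_feSpace (hH : 0 < H) (hΓ : G.MeshAligned H)
    {a : (i : Fin d) → Fin (N i + 1)} (ha : meshNode H a ∉ G.Γ) :
    nodalBasis H a ∈ G.feSpace H := by
  refine ⟨(continuous_nodalBasis H a).continuousOn,
    fun T hT => G.nodalBasis_multilinear hH a hT, fun z hz => ?_⟩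
  obtain ⟨𝓕, hF, hΓ⟩ := hΓ
  rw [hΓ] at hz ha
  obtain ⟨F, hFm, hzF⟩ := hz
  by_contra h
  exact ha ⟨F, hFm, G.meshNode_mem_face hH a (hF F hFm) hzF h⟩

end SpatialNetwork

namespace SpatialNetwork

variable {d : ℕ} (G : SpatialNetwork d)

/-! ### Mass and Laplacian as weighted sums -/

open Classical in
/-- Half the length of the edge `{x, y}`, and zero if `x` and `y` are not adjacent. -/
noncomputable def halfLength (x y : G.nodes) : ℝ :=
  if G.graph.Adj x y then ‖(x : Pt d) - (y : Pt d)‖ / 2 else 0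

open Classical in
/-- The weight of the pair `(x, y)` in the form of the Laplacian. -/
noncomputable def conductance (x y : G.nodes) : ℝ :=
  if G.graph.Adj x y then 1 / (2 * ‖(x : Pt d) - (y : Pt d)‖) else 0

/-- The mass of a node: half the total length of the adjacent edges. -/
noncomputable def nodeMass (x : G.nodes) : ℝ := ∑ y, G.halfLength x y

theorem halfLength_nonneg (x y : G.nodes) : 0 ≤ G.halfLength x y := by
  unfold halfLength; split_ifs <;> positivity

theorem conductance_nonneg (x y : G.nodes) : 0 ≤ G.conductance x y := by
  unfold conductance; split_ifs <;> positivity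

theorem nodeMass_nonneg (x : G.nodes) : 0 ≤ G.nodeMass x :=
  Finset.sum_nonneg fun _ _ => G.halfLength_nonneg _ _

theorem norm_pos_of_adj {x y : G.nodes} (h : G.graph.Adj x y) :
    0 < ‖(x : Pt d) - (y : Pt d)‖ :=
  norm_pos_iff.2 (sub_ne_zero.2 fun h' => h.ne (Subtype.ext h'))

theorem conductance_mul_norm_sq (x y : G.nodes) :
    G.conductance x y * ‖(x : Pt d) - (y : Pt d)‖ ^ 2 = G.halfLength x y := by
  unfold conductance halfLength
  split_ifs with h
  · have := G.norm_pos_of_adj h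
    field_simp
  · simp

open Classical in
theorem massForm_eq (ω : Set (Pt d)) (v : G.Fun) :
    G.massForm ω v = ∑ x : G.nodes, if (x : Pt d) ∈ ω then G.nodeMass x * v x ^ 2 else 0 := by
  unfold massForm nodeMass halfLength
  refine Finset.sum_congr rfl fun x _ => ?_
  congr 1
  rw [Finset.mul_sum, Finset.sum_mul]
  refine Finset.sum_congr rfl fun y _ => ?_
  split_ifs <;> ring

open Classical in
theorem lapForm_eq (ω : Set (Pt d)) (v : G.Fun) :
    G.lapForm ω v = ∑ x : G.nodes, if (x : Pt d) ∈ ω then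
      ∑ y, G.conductance x y * (v x - v y) ^ 2 else 0 := by
  unfold lapForm conductance
  refine Finset.sum_congr rfl fun x _ => ?_
  congr 1
  rw [Finset.mul_sum]
  refine Finset.sum_congr rfl fun y _ => ?_
  split_ifs with h
  · have := G.norm_pos_of_adj h
    field_simp
  · simp

theorem massForm_Ω (v : G.Fun) : G.massForm G.Ω v = ∑ x, G.nodeMass x * v x ^ 2 := by
  classical
  rw [massForm_eq]
  exact Finset.sum_congr rfl fun x _ => if_pos (G.nodes_mem x x.2)

theorem lapForm_Ω (v : G.Fun) :
    G.lapForm G.Ω v = ∑ x, ∑ y, G.conductance x y * (v x - v y) ^ 2 := by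
  classical
  rw [lapForm_eq]
  exact Finset.sum_congr rfl fun x _ => if_pos (G.nodes_mem x x.2)

theorem massForm_nonneg (ω : Set (Pt d)) (v : G.Fun) : 0 ≤ G.massForm ω v := by
  classical
  rw [massForm_eq]
  refine Finset.sum_nonneg fun x _ => ?_
  split_ifs
  · exact mul_nonneg (G.nodeMass_nonneg x) (sq_nonneg _)
  · exact le_rfl

theorem sum_conductance_nonneg (v : G.Fun) (x : G.nodes) :
    0 ≤ ∑ y, G.conductance x y * (v x - v y) ^ 2 :=
  Finset.sum_nonneg fun _ _ => mul_nonneg (G.conductance_nonneg _ _) (sq_nonneg _)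

theorem lapForm_nonneg (ω : Set (Pt d)) (v : G.Fun) : 0 ≤ G.lapForm ω v := by
  classical
  rw [lapForm_eq]
  refine Finset.sum_nonneg fun x _ => ?_
  split_ifs
  · exact G.sum_conductance_nonneg v x
  · exact le_rfl

theorem massForm_mono {ω ω' : Set (Pt d)} (v : G.Fun)
    (h : ∀ x : G.nodes, (x : Pt d) ∈ ω → (x : Pt d) ∈ ω') :
    G.massForm ω v ≤ G.massForm ω' v := by
  classical
  rw [massForm_eq, massForm_eq]
  refine Finset.sum_le_sum fun x _ => ?_
  have := mul_nonneg (G.nodeMass_nonneg x) (sq_nonneg (v x))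
  split_ifs with h1 h2
  · exact le_rfl
  · exact absurd (h x h1) h2
  · exact this
  · exact le_rfl

theorem massNorm_sq (ω : Set (Pt d)) (v : G.Fun) : G.massNorm ω v ^ 2 = G.massForm ω v :=
  Real.sq_sqrt (G.massForm_nonneg ω v)

theorem lapNorm_sq (ω : Set (Pt d)) (v : G.Fun) : G.lapNorm ω v ^ 2 = G.lapForm ω v :=
  Real.sq_sqrt (G.lapForm_nonneg ω v)

theorem massForm_le_of_massNorm_le {ω ω' : Set (Pt d)} {v w : G.Fun} {t : ℝ}
    (h : G.massNorm ω v ≤ t * G.lapNorm ω' w) : G.massForm ω v ≤ t ^ 2 * G.lapForm ω' w := by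
  rw [← massNorm_sq, ← lapNorm_sq, ← mul_pow]
  exact pow_le_pow_left₀ (Real.sqrt_nonneg _) h 2

theorem lapForm_add_le (v w : G.Fun) :
    G.lapForm G.Ω (v + w) ≤ 2 * G.lapForm G.Ω v + 2 * G.lapForm G.Ω w := by
  simp only [lapForm_Ω, Finset.mul_sum, ← Finset.sum_add_distrib]
  refine Finset.sum_le_sum fun x _ => Finset.sum_le_sum fun y _ => ?_
  have h := G.conductance_nonneg x y
  have h2 : (v x + w x - (v y + w y)) ^ 2 ≤ 2 * (v x - v y) ^ 2 + 2 * (w x - w y) ^ 2 := by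
    nlinarith [sq_nonneg ((v x - v y) - (w x - w y))]
  simp only [Pi.add_apply]
  nlinarith

theorem lapForm_neg (v : G.Fun) : G.lapForm G.Ω (-v) = G.lapForm G.Ω v := by
  simp only [lapForm_Ω, Pi.neg_apply]
  refine Finset.sum_congr rfl fun x _ => Finset.sum_congr rfl fun y _ => ?_
  ring

theorem lapForm_sub_le (v w : G.Fun) :
    G.lapForm G.Ω (v - w) ≤ 2 * G.lapForm G.Ω v + 2 * G.lapForm G.Ω w := by
  rw [sub_eq_add_neg, ← G.lapForm_neg w]
  exact G.lapForm_add_le v (-w)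

/-- The local Laplacian of a function with unit slope is dominated by the mass. -/
theorem lapForm_le_massForm_one (ω : Set (Pt d)) (v : G.Fun)
    (hv : ∀ x y : G.nodes, |v x - v y| ≤ ‖(x : Pt d) - (y : Pt d)‖) :
    G.lapForm ω v ≤ G.massForm ω 1 := by
  classical
  rw [lapForm_eq, massForm_eq]
  refine Finset.sum_le_sum fun x _ => ?_
  split_ifs
  · rw [Pi.one_apply, one_pow, mul_one]
    refine Finset.sum_le_sum fun y _ => ?_
    rw [← conductance_mul_norm_sq]
    refine mul_le_mul_of_nonneg_left ?_ (G.conductance_nonneg x y)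
    rw [← sq_abs]
    exact pow_le_pow_left₀ (abs_nonneg _) (hv x y) 2
  · exact le_rfl

theorem massForm_mul_sq_le (ω : Set (Pt d)) {v : G.Fun} {t : ℝ}
    (hv : ∀ x : G.nodes, (x : Pt d) ∈ ω → t ≤ v x ^ 2) :
    t * G.massForm ω 1 ≤ G.massForm ω v := by
  classical
  rw [massForm_eq, massForm_eq, Finset.mul_sum]
  refine Finset.sum_le_sum fun x _ => ?_
  split_ifs with h
  · rw [Pi.one_apply, one_pow, mul_one, mul_comm]
    exact mul_le_mul_of_nonneg_left (hv x h) (G.nodeMass_nonneg x)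
  · simp

/-! ### Finite overlap -/

theorem sq_sum_le_card_mul {A : Type*} [Fintype A] (t : A → ℝ) (s : Finset A)
    (hs : ∀ a, a ∉ s → t a = 0) : (∑ a, t a) ^ 2 ≤ s.card * ∑ a, t a ^ 2 := by
  rw [← Finset.sum_subset (Finset.subset_univ s) fun a _ ha => hs a ha,
    ← Finset.sum_subset (Finset.subset_univ s) fun a _ ha => by rw [hs a ha]; simp]
  exact sq_sum_le_card_mul_sum_sq

open Classical in
/-- The sets `ω a` overlap at most `Q`-fold at the nodes. -/
def OverlapLE {A : Type*} [Fintype A] (ω : A → Set (Pt d)) (Q : ℝ) : Prop :=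
  ∀ x : G.nodes, ((Finset.univ.filter fun a => (x : Pt d) ∈ ω a).card : ℝ) ≤ Q

variable {G} {A : Type*} [Fintype A] {ω : A → Set (Pt d)} {Q : ℝ}

theorem OverlapLE.sum_lapForm_le (h : G.OverlapLE ω Q) (v : G.Fun) :
    ∑ a, G.lapForm (ω a) v ≤ Q * G.lapForm G.Ω v := by
  classical
  simp only [lapForm_eq _ (ω _)]
  rw [lapForm_Ω, Finset.sum_comm, Finset.mul_sum]
  refine Finset.sum_le_sum fun x _ => ?_
  rw [← Finset.sum_filter, Finset.sum_const, nsmul_eq_mul]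
  exact mul_le_mul_of_nonneg_right (h x) (G.sum_conductance_nonneg v x)

/-- A strengthened triangle inequality for functions with supports of finite overlap. -/
theorem OverlapLE.lapForm_sum_le (h : G.OverlapLE ω Q) (w : A → G.Fun)
    (hw : ∀ a, ∀ x : G.nodes, (x : Pt d) ∉ ω a → w a x = 0) :
    G.lapForm G.Ω (∑ a, w a) ≤ 2 * Q * ∑ a, G.lapForm G.Ω (w a) := by
  classical
  simp only [lapForm_Ω]
  conv_rhs => rw [Finset.sum_comm, Finset.mul_sum]
  refine Finset.sum_le_sum fun x _ => ?_
  conv_rhs => rw [Finset.sum_comm, Finset.mul_sum]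
  refine Finset.sum_le_sum fun y _ => ?_
  rw [← Finset.mul_sum, mul_left_comm]
  refine mul_le_mul_of_nonneg_left ?_ (G.conductance_nonneg x y)
  rw [Finset.sum_apply, Finset.sum_apply, ← Finset.sum_sub_distrib]
  set s := (Finset.univ.filter fun a => (x : Pt d) ∈ ω a) ∪
    (Finset.univ.filter fun a => (y : Pt d) ∈ ω a) with hs
  refine (sq_sum_le_card_mul (fun a => w a x - w a y) s fun a ha => ?_).trans ?_
  · simp only [hs, Finset.mem_union, Finset.mem_filter, Finset.mem_univ, true_and, not_or] at ha
    rw [hw a x ha.1, hw a y ha.2, sub_zero]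
  · refine mul_le_mul_of_nonneg_right ?_ (Finset.sum_nonneg fun a _ => sq_nonneg _)
    have h1 : (s.card : ℝ) ≤ ((Finset.univ.filter fun a => (x : Pt d) ∈ ω a).card : ℝ) +
        ((Finset.univ.filter fun a => (y : Pt d) ∈ ω a).card : ℝ) := by
      exact_mod_cast Finset.card_union_le _ _
    have := h x
    have := h y
    linarith

/-! ### Decompositions from a partition of unity -/

/-- A partition of unity on the nodes with overlap at most `Q` and Lipschitz constant `L`. Both
endpoints of an edge have to lie outside the support of `φ a` if one of them lies outside `ω a`. -/
structure IsPartitionOfUnity (φ : A → G.Fun) (ω : A → Set (Pt d)) (Q L : ℝ) : Prop where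
  nonneg : ∀ a (x : G.nodes), 0 ≤ φ a x
  sum_eq_one : ∀ x : G.nodes, ∑ a, φ a x = 1
  lipschitz : ∀ a (x y : G.nodes), |φ a x - φ a y| ≤ L * ‖(x : Pt d) - (y : Pt d)‖
  eq_zero : ∀ a (x : G.nodes), (x : Pt d) ∉ ω a → φ a x = 0
  eq_zero_of_adj : ∀ a (x y : G.nodes), G.graph.Adj x y → (x : Pt d) ∉ ω a → φ a y = 0
  overlap : G.OverlapLE ω Q

namespace IsPartitionOfUnity

variable {φ : A → G.Fun} {L : ℝ}

theorem sum_sq_le_one (h : IsPartitionOfUnity φ ω Q L) (x : G.nodes) : ∑ a, φ a x ^ 2 ≤ 1 := by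
  rw [← h.sum_eq_one x]
  refine Finset.sum_le_sum fun a _ => ?_
  have h1 : φ a x ≤ 1 := by
    rw [← h.sum_eq_one x]
    exact Finset.single_le_sum (fun b _ => h.nonneg b x) (Finset.mem_univ a)
  nlinarith [h.nonneg a x]

open Classical in
theorem conductance_mul_sub_sq_le (h : IsPartitionOfUnity φ ω Q L) (a : A) (x y : G.nodes) :
    G.conductance x y * (φ a x - φ a y) ^ 2 ≤
      if (x : Pt d) ∈ ω a then L ^ 2 * G.halfLength x y else 0 := by
  split_ifs with hx
  · rw [← conductance_mul_norm_sq, mul_left_comm, ← mul_pow]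
    refine mul_le_mul_of_nonneg_left ?_ (G.conductance_nonneg x y)
    rw [← sq_abs]
    exact pow_le_pow_left₀ (abs_nonneg _) (h.lipschitz a x y) 2
  · by_cases hadj : G.graph.Adj x y
    · rw [h.eq_zero a x hx, h.eq_zero_of_adj a x y hadj hx]; simp
    · rw [conductance, if_neg hadj, zero_mul]

/-- The coarse part is stable in the Laplacian norm: its difference across an edge at `x` does not
change if `v x` is subtracted from all coefficients. -/
theorem lapForm_coarse_le (h : IsPartitionOfUnity φ ω Q L) (v : G.Fun) (c : A → ℝ) :
    G.lapForm G.Ω (fun x => ∑ a, c a * φ a x) ≤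
      Q * L ^ 2 * ∑ a, G.massForm (ω a) (fun x => v x - c a) := by
  classical
  rw [lapForm_Ω]
  simp only [massForm_eq]
  conv_rhs => rw [Finset.sum_comm, Finset.mul_sum]
  refine Finset.sum_le_sum fun x _ => ?_
  have hedge : ∀ y, G.conductance x y * (∑ a, c a * φ a x - ∑ a, c a * φ a y) ^ 2 ≤
      ∑ a, if (x : Pt d) ∈ ω a then
        Q * L ^ 2 * (G.halfLength x y * (v x - c a) ^ 2) else 0 := by
    intro y
    by_cases hadj : G.graph.Adj x y
    swap
    · rw [conductance, if_neg hadj, zero_mul]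
      refine Finset.sum_nonneg fun a _ => ?_
      rw [halfLength, if_neg hadj]
      simp
    have e : ∑ a, c a * φ a x - ∑ a, c a * φ a y =
        ∑ a, (c a - v x) * (φ a x - φ a y) := by
      have hx : ∑ a, v x * φ a x = v x := by rw [← Finset.mul_sum, h.sum_eq_one, mul_one]
      have hy : ∑ a, v x * φ a y = v x := by rw [← Finset.mul_sum, h.sum_eq_one, mul_one]
      simp only [sub_mul, mul_sub, Finset.sum_sub_distrib, hx, hy]
      ring
    have h1 := sq_sum_le_card_mul (fun a => (c a - v x) * (φ a x - φ a y))
      (Finset.univ.filter fun a => (x : Pt d) ∈ ω a) fun a ha => by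
        have hx : (x : Pt d) ∉ ω a := by simpa using ha
        rw [h.eq_zero a x hx, h.eq_zero_of_adj a x y hadj hx, sub_zero, mul_zero]
    have h2 : (∑ a, (c a - v x) * (φ a x - φ a y)) ^ 2 ≤
        Q * ∑ a, ((c a - v x) * (φ a x - φ a y)) ^ 2 :=
      h1.trans (mul_le_mul_of_nonneg_right (h.overlap x)
        (Finset.sum_nonneg fun a _ => sq_nonneg _))
    have hQ : 0 ≤ Q := (Nat.cast_nonneg _).trans (h.overlap x)
    rw [e]
    refine (mul_le_mul_of_nonneg_left h2 (G.conductance_nonneg x y)).trans ?_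
    rw [mul_left_comm, Finset.mul_sum, Finset.mul_sum]
    refine Finset.sum_le_sum fun a _ => ?_
    have h3 := h.conductance_mul_sub_sq_le a x y
    split_ifs at h3 ⊢
    · have := mul_le_mul_of_nonneg_left h3 (mul_nonneg hQ (sq_nonneg (v x - c a)))
      calc _ = Q * (v x - c a) ^ 2 * (G.conductance x y * (φ a x - φ a y) ^ 2) := by ring
        _ ≤ _ := this
        _ = _ := by ring
    · have := mul_le_mul_of_nonneg_left h3 (mul_nonneg hQ (sq_nonneg (v x - c a)))
      calc _ = Q * (v x - c a) ^ 2 * (G.conductance x y * (φ a x - φ a y) ^ 2) := by ring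
        _ ≤ _ := this
        _ = 0 := by ring
  refine (Finset.sum_le_sum fun y _ => hedge y).trans (le_of_eq ?_)
  rw [Finset.sum_comm, Finset.mul_sum]
  refine Finset.sum_congr rfl fun a _ => ?_
  split_ifs
  · rw [nodeMass, Finset.sum_mul, Finset.mul_sum]
  · simp

theorem massForm_sub_coarse_le (h : IsPartitionOfUnity φ ω Q L) (v : G.Fun) (c : A → ℝ) :
    G.massForm G.Ω (fun x => v x - ∑ a, c a * φ a x) ≤
      ∑ a, G.massForm (ω a) (fun x => v x - c a) := by
  classical
  rw [massForm_Ω]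
  simp only [massForm_eq]
  rw [Finset.sum_comm]
  refine Finset.sum_le_sum fun x _ => ?_
  have e : v x - ∑ a, c a * φ a x = ∑ a, φ a x * (v x - c a) := by
    have hx : ∑ a, φ a x * v x = v x := by rw [← Finset.sum_mul, h.sum_eq_one, one_mul]
    simp only [mul_sub, Finset.sum_sub_distrib, hx]
    congr 1
    exact Finset.sum_congr rfl fun a _ => mul_comm _ _
  have h1 : (v x - ∑ a, c a * φ a x) ^ 2 ≤ ∑ a, φ a x * (v x - c a) ^ 2 := by
    rw [e]
    -- Jensen's inequality for the square
    have := (Even.convexOn_pow (𝕜 := ℝ) even_two).map_sum_le (t := Finset.univ)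
      (w := fun a => φ a x) (p := fun a => v x - c a) (fun a _ => h.nonneg a x) (h.sum_eq_one x)
      (fun _ _ => Set.mem_univ _)
    simpa only [smul_eq_mul] using this
  refine (mul_le_mul_of_nonneg_left h1 (G.nodeMass_nonneg x)).trans ?_
  rw [Finset.mul_sum]
  refine Finset.sum_le_sum fun a _ => ?_
  split_ifs with hx
  · have hφ : φ a x ≤ 1 := by
      rw [← h.sum_eq_one x]
      exact Finset.single_le_sum (fun b _ => h.nonneg b x) (Finset.mem_univ a)
    refine mul_le_mul_of_nonneg_left ?_ (G.nodeMass_nonneg x)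
    nlinarith [sq_nonneg (v x - c a)]
  · rw [h.eq_zero a x hx]; simp

/-- The localized parts are stable, by the product rule. -/
theorem sum_lapForm_mul_le (h : IsPartitionOfUnity φ ω Q L) (w : G.Fun) :
    ∑ a, G.lapForm G.Ω (fun x => φ a x * w x) ≤
      2 * G.lapForm G.Ω w + 2 * (Q * L ^ 2) * G.massForm G.Ω w := by
  classical
  simp only [lapForm_Ω, massForm_Ω]
  rw [Finset.sum_comm, Finset.mul_sum, Finset.mul_sum, ← Finset.sum_add_distrib]
  refine Finset.sum_le_sum fun x _ => ?_
  rw [Finset.sum_comm, nodeMass, Finset.sum_mul, Finset.mul_sum, Finset.mul_sum,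
    ← Finset.sum_add_distrib]
  refine Finset.sum_le_sum fun y _ => ?_
  have hc := G.conductance_nonneg x y
  have h1 : ∀ a, G.conductance x y * (φ a x * w x - φ a y * w y) ^ 2 ≤
      2 * (G.conductance x y * (w x - w y) ^ 2) * φ a y ^ 2 +
        2 * w x ^ 2 * (G.conductance x y * (φ a x - φ a y) ^ 2) := by
    intro a
    have e : φ a x * w x - φ a y * w y = φ a y * (w x - w y) + w x * (φ a x - φ a y) := by ring
    have : (φ a x * w x - φ a y * w y) ^ 2 ≤
        2 * (φ a y * (w x - w y)) ^ 2 + 2 * (w x * (φ a x - φ a y)) ^ 2 := by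
      rw [e]
      nlinarith [sq_nonneg (φ a y * (w x - w y) - w x * (φ a x - φ a y))]
    calc _ ≤ G.conductance x y *
          (2 * (φ a y * (w x - w y)) ^ 2 + 2 * (w x * (φ a x - φ a y)) ^ 2) := by gcongr
      _ = _ := by ring
  have h2 : ∑ a, G.conductance x y * (φ a x - φ a y) ^ 2 ≤ Q * (L ^ 2 * G.halfLength x y) := by
    refine (Finset.sum_le_sum fun a _ => h.conductance_mul_sub_sq_le a x y).trans ?_
    rw [← Finset.sum_filter, Finset.sum_const, nsmul_eq_mul]
    exact mul_le_mul_of_nonneg_right (h.overlap x)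
      (mul_nonneg (sq_nonneg L) (G.halfLength_nonneg x y))
  refine (Finset.sum_le_sum fun a _ => h1 a).trans ?_
  rw [Finset.sum_add_distrib, ← Finset.mul_sum, ← Finset.mul_sum]
  have h3 := mul_le_mul_of_nonneg_left (h.sum_sq_le_one y)
    (by positivity : 0 ≤ 2 * (G.conductance x y * (w x - w y) ^ 2))
  have h4 := mul_le_mul_of_nonneg_left h2 (by positivity : 0 ≤ 2 * w x ^ 2)
  nlinarith

/-- Stability of the decomposition of `v` into the coarse function with coefficients `c` and the
localized remainders. -/
theorem stable_decomposition (h : IsPartitionOfUnity φ ω Q L) (hQ : 0 ≤ Q) (v : G.Fun)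
    (c : A → ℝ) :
    G.lapForm G.Ω (fun x => ∑ a, c a * φ a x) +
        ∑ a, G.lapForm G.Ω (fun x => φ a x * (v x - ∑ b, c b * φ b x)) ≤
      4 * G.lapForm G.Ω v +
        7 * (Q * L ^ 2) * ∑ a, G.massForm (ω a) (fun x => v x - c a) := by
  have h1 := h.lapForm_coarse_le v c
  have h2 := mul_le_mul_of_nonneg_left (h.massForm_sub_coarse_le v c)
    (by positivity : 0 ≤ 2 * (Q * L ^ 2))
  have h3 := h.sum_lapForm_mul_le (fun x => v x - ∑ b, c b * φ b x)
  have h4 := G.lapForm_sub_le v (fun x => ∑ b, c b * φ b x)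
  have e : (v - fun x => ∑ b, c b * φ b x) = fun x => v x - ∑ b, c b * φ b x := rfl
  rw [e] at h4
  linarith

end IsPartitionOfUnity

end SpatialNetwork

namespace SpatialNetwork

variable {d : ℕ} {G : SpatialNetwork d} {H R₀ σ ρ μ : ℝ} {N : Fin d → ℕ}

/-! ### Existence of a Poincaré constant -/

theorem exists_adj_of_nodeMass_ne_zero {y : G.nodes} (h : G.nodeMass y ≠ 0) :
    ∃ z, G.graph.Adj y z := by
  by_contra hc
  push Not at hc
  refine h (Finset.sum_eq_zero fun z _ => ?_)
  rw [halfLength, if_neg (hc z)]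

/-- The jump across an edge is controlled by any local Laplacian that sees the edge. -/
theorem sub_sq_le_lapForm (hloc : ∀ x y : G.nodes, G.graph.Adj x y →
      ‖(x : Pt d) - (y : Pt d)‖ < R₀) {ω : Set (Pt d)} {y z : G.nodes} (hadj : G.graph.Adj y z)
    (hy : (y : Pt d) ∈ ω) (v : G.Fun) : (v y - v z) ^ 2 ≤ 2 * R₀ * G.lapForm ω v := by
  classical
  have hpos := G.norm_pos_of_adj hadj
  have h1 : G.conductance y z * (v y - v z) ^ 2 ≤ G.lapForm ω v := by
    rw [lapForm_eq]
    calc G.conductance y z * (v y - v z) ^ 2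
        ≤ ∑ w, G.conductance y w * (v y - v w) ^ 2 :=
          Finset.single_le_sum (f := fun w => G.conductance y w * (v y - v w) ^ 2)
            (fun w _ => mul_nonneg (G.conductance_nonneg _ _) (sq_nonneg _)) (Finset.mem_univ z)
      _ = if (y : Pt d) ∈ ω then ∑ w, G.conductance y w * (v y - v w) ^ 2 else 0 := by
          rw [if_pos hy]
      _ ≤ _ := Finset.single_le_sum (f := fun x : G.nodes => if (x : Pt d) ∈ ω then
            ∑ w, G.conductance x w * (v x - v w) ^ 2 else 0) (fun x _ => by
              split_ifs
              · exact G.sum_conductance_nonneg v x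
              · exact le_rfl) (Finset.mem_univ y)
  have h2 : (v y - v z) ^ 2 ≤ 2 * ‖(y : Pt d) - (z : Pt d)‖ * G.lapForm ω v := by
    rw [conductance, if_pos hadj, one_div, inv_mul_le_iff₀ (by positivity)] at h1
    exact h1
  have h3 := (hloc y z hadj).le
  have h4 := G.lapForm_nonneg ω v
  nlinarith

/-- In a connected subgraph with edges in `ω`, values differ by at most the number of nodes times
the largest jump. -/
theorem abs_sub_le_of_connected (hloc : ∀ x y : G.nodes, G.graph.Adj x y →
      ‖(x : Pt d) - (y : Pt d)‖ < R₀) {ω : Set (Pt d)} {S : G.graph.Subgraph} (hS : S.Connected)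
    (hSω : ∀ y z : G.nodes, S.Adj y z → (y : Pt d) ∈ ω ∧ (z : Pt d) ∈ ω) (v : G.Fun)
    {y z : G.nodes} (hy : y ∈ S.verts) (hz : z ∈ S.verts) :
    |v y - v z| ≤ Fintype.card G.nodes * √(2 * R₀ * G.lapForm ω v) := by
  classical
  set δ := √(2 * R₀ * G.lapForm ω v) with hδ
  have hwalk : ∀ (a b : S.verts) (p : S.coe.Walk a b), |v a - v b| ≤ p.length * δ := by
    intro a b p
    induction p with
    | nil => simp
    | @cons a b c h p ih =>
      have h1 : |v a - v b| ≤ δ :=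
        Real.abs_le_sqrt (sub_sq_le_lapForm hloc (S.adj_sub h) (hSω _ _ h).1 v)
      have h2 := abs_sub_le (v a) (v b) (v c)
      rw [SimpleGraph.Walk.length_cons]
      push_cast
      linarith
  obtain ⟨p⟩ := hS.coe.preconnected ⟨y, hy⟩ ⟨z, hz⟩
  refine (hwalk _ _ p.bypass).trans ?_
  gcongr
  have h1 := (p.bypass_isPath).length_lt
  have h2 : Fintype.card S.verts ≤ Fintype.card G.nodes :=
    Fintype.card_le_of_injective _ Subtype.val_injective
  omega

theorem exists_isPoincareConstant (hG : G.NetworkAssumption R₀ σ ρ) :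
    ∃ μ : ℝ, G.IsPoincareConstant R₀ μ := by
  classical
  have hR₀ := hG.scale_pos
  set n : ℝ := (Fintype.card G.nodes : ℝ) with hn
  set D : ℝ := ∑ x, G.nodeMass x with hD
  have hD0 : 0 ≤ D := Finset.sum_nonneg fun x _ => G.nodeMass_nonneg x
  -- it suffices to bound `v - c` by `n √(2 R₀ |v|²_L)` at the nodes that carry mass
  have key : ∀ R, R₀ ≤ R → ∀ x, ∀ v w : G.Fun,
      (∀ y : G.nodes, (y : Pt d) ∈ G.box R x → G.nodeMass y ≠ 0 →
        |w y| ≤ n * √(2 * R₀ * G.lapForm (G.box (R + R₀) x) v)) →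
      G.massNorm (G.box R x) w ≤
        √(D * n ^ 2 * (2 * R₀)) / R₀ * R * G.lapNorm (G.box (R + R₀) x) v := by
    intro R hR x v w hw
    have hL := G.lapForm_nonneg (G.box (R + R₀) x) v
    have hmass : G.massForm (G.box R x) w ≤
        D * n ^ 2 * (2 * R₀) * G.lapForm (G.box (R + R₀) x) v := by
      rw [massForm_eq, hD]
      simp only [Finset.sum_mul]
      refine Finset.sum_le_sum fun y _ => ?_
      have h0 := G.nodeMass_nonneg y
      split_ifs with hy
      · by_cases hm : G.nodeMass y = 0
        · simp [hm]
        · have h1 := pow_le_pow_left₀ (abs_nonneg _) (hw y hy hm) 2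
          rw [sq_abs, mul_pow, Real.sq_sqrt (by positivity)] at h1
          calc _ ≤ G.nodeMass y * (n ^ 2 * (2 * R₀ * G.lapForm (G.box (R + R₀) x) v)) := by
                gcongr
            _ = _ := by ring
      · positivity
    calc G.massNorm (G.box R x) w
        ≤ √(D * n ^ 2 * (2 * R₀) * G.lapForm (G.box (R + R₀) x) v) := Real.sqrt_le_sqrt hmass
      _ = √(D * n ^ 2 * (2 * R₀)) / R₀ * R₀ * G.lapNorm (G.box (R + R₀) x) v := by
          rw [Real.sqrt_mul (by positivity), lapNorm, div_mul_cancel₀ _ hR₀.ne']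
      _ ≤ _ := by
          have : 0 ≤ G.lapNorm (G.box (R + R₀) x) v := Real.sqrt_nonneg _
          gcongr
  refine ⟨√(D * n ^ 2 * (2 * R₀)) / R₀, by positivity, ?_, ?_⟩
  · rintro R hR x hx ⟨z, hzn, hzΓ, hzx⟩ v hv
    obtain ⟨S, hS, hS1, hS2⟩ := hG.connectivity R hR x hx
    refine key R hR x v v fun y hy hm => ?_
    obtain ⟨y', hyy'⟩ := exists_adj_of_nodeMass_ne_zero hm
    obtain ⟨z', hzz'⟩ : ∃ z', G.graph.Adj ⟨z, hzn⟩ z' := by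
      obtain ⟨p⟩ := G.connected.preconnected ⟨z, hzn⟩ y
      cases p with
      | nil => exact ⟨y', hyy'⟩
      | cons h _ => exact ⟨_, h⟩
    have h := abs_sub_le_of_connected hG.locality hS hS2 v
      (S.edge_vert (hS1 _ _ hyy' (Or.inl hy))) (S.edge_vert (hS1 _ _ hzz' (Or.inl hzx)))
    rwa [hv ⟨z, hzn⟩ hzΓ, sub_zero] at h
  · intro R hR x hx v
    obtain ⟨S, hS, hS1, hS2⟩ := hG.connectivity R hR x hx
    obtain ⟨z⟩ := hS.coe.nonempty
    refine ⟨v z, key R hR x v _ fun y hy hm => ?_⟩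
    obtain ⟨y', hyy'⟩ := exists_adj_of_nodeMass_ne_zero hm
    exact abs_sub_le_of_connected hG.locality hS hS2 v
      (S.edge_vert (hS1 _ _ hyy' (Or.inl hy))) z.2

/-! ### Lower bound for the Poincaré constant -/

theorem mass_cell (hG : G.NetworkAssumption R₀ σ ρ) (hH : 2 * R₀ ≤ H)
    (hside : ∀ i, G.side i = N i * H) {k : Fin d → ℕ} (hk : ∀ i, k i < N i) :
    ρ * H ^ d ≤ G.massForm (G.box (H / 2) (cellCenter H k)) 1 ∧
      G.massForm (G.box (H / 2) (cellCenter H k)) 1 ≤ σ * ρ * H ^ d := by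
  have hR₀ := hG.scale_pos
  have hHpos : 0 < H := by linarith
  have h := hG.homogeneity (H / 2) (by linarith) _ (G.isCenter_cellCenter hHpos hside hk).1
    (G.boxInside_cellCenter hHpos hside hk)
  have hd : 0 < H ^ d := by positivity
  rw [massNorm_sq, show 2 * (H / 2) = H by ring, le_inv_mul_iff₀ hd, inv_mul_le_iff₀ hd] at h
  exact ⟨by linarith [h.1], by linarith [h.2]⟩

theorem count_pos_of_side (hH : 0 < H) (hside : ∀ i, G.side i = N i * H) (i : Fin d) :
    0 < N i := by
  have h := G.side_pos i
  rw [hside] at h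
  exact_mod_cast pos_of_mul_pos_left h hH.le

theorem one_le_sigma (hG : G.NetworkAssumption R₀ σ ρ) (hH : 2 * R₀ ≤ H)
    (hside : ∀ i, G.side i = N i * H) : 1 ≤ σ := by
  have hR₀ := hG.scale_pos
  have hHpos : 0 < H := by linarith
  obtain ⟨h1, h2⟩ := mass_cell hG hH hside (k := fun _ => 0)
    fun i => count_pos_of_side hHpos hside i
  have h3 : 0 < ρ * H ^ d := mul_pos hG.density_pos (by positivity)
  by_contra hc
  push Not at hc
  nlinarith

theorem massForm_le_sum {B : Type*} (s : Finset B) {ω : Set (Pt d)} {ω' : B → Set (Pt d)}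
    (h : ∀ x : G.nodes, (x : Pt d) ∈ ω → ∃ b ∈ s, (x : Pt d) ∈ ω' b) (v : G.Fun) :
    G.massForm ω v ≤ ∑ b ∈ s, G.massForm (ω' b) v := by
  classical
  simp only [massForm_eq]
  rw [Finset.sum_comm]
  refine Finset.sum_le_sum fun x _ => ?_
  have h0 := mul_nonneg (G.nodeMass_nonneg x) (sq_nonneg (v x))
  have hnn : ∀ b ∈ s, 0 ≤ if (x : Pt d) ∈ ω' b then G.nodeMass x * v x ^ 2 else 0 := by
    intro b _
    split_ifs
    · exact h0
    · exact le_rfl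
  split_ifs with hx
  · obtain ⟨b, hb, hxb⟩ := h x hx
    have := Finset.single_le_sum hnn hb
    rwa [if_pos hxb] at this
  · exact Finset.sum_nonneg hnn

/-- If there are three elements in a row, then the coordinate function in this direction shows that
a Poincaré constant cannot be small compared with `σ^(-1/2)`. -/
theorem one_le_of_three_le (hG : G.NetworkAssumption R₀ σ ρ) (hH : 2 * R₀ ≤ H)
    (hside : ∀ i, G.side i = N i * H) (hμ : G.IsPoincareConstant R₀ μ) {i : Fin d}
    (hi : 3 ≤ N i) : 1 ≤ 9 * 4 ^ d * (σ * μ ^ 2) := by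
  classical
  have hR₀ := hG.scale_pos
  have hHpos : 0 < H := by linarith
  have hρ := hG.density_pos
  have hNpos := count_pos_of_side hHpos hside
  -- the element in the middle of the row; the outer ones are `Pi.single i 0` and `Pi.single i 2`
  set km : Fin d → ℕ := Pi.single i 1 with hkm
  have hkN : ∀ m : ℕ, m < 3 → ∀ j, (Pi.single i m : Fin d → ℕ) j < N j := by
    intro m hm j
    by_cases hj : j = i
    · subst hj; rw [Pi.single_eq_same]; omega
    · rw [Pi.single_eq_of_ne hj]; exact hNpos j
  have hm1 : ∀ j, (km j : ℝ) ≤ 1 ∧ 0 ≤ (km j : ℝ) := by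
    intro j
    by_cases hj : j = i
    · subst hj; simp [hkm]
    · simp [hkm, Pi.single_eq_of_ne hj]
  set x : Pt d := cellCenter H km with hx
  set v : G.Fun := fun z => (z : Pt d) i with hv
  obtain ⟨c, hc⟩ := hμ.poincare (3 * H / 2) (by linarith) x
    (G.isCenter_cellCenter hHpos hside (hkN 1 (by norm_num))).1 v
  have h1 := G.massForm_le_of_massNorm_le hc
  -- upper bound for the energy of the coordinate function
  have h2 : G.lapForm (G.box (3 * H / 2 + R₀) x) v ≤ 4 ^ d * (σ * ρ * H ^ d) := by
    refine (G.lapForm_le_massForm_one _ v fun y z =>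
      PiLp.norm_apply_le ((y : Pt d) - (z : Pt d)) i).trans ?_
    set s : Finset (Fin d → ℕ) :=
      (Fintype.piFinset fun _ => Finset.range 4).filter fun k => ∀ j, k j < N j with hs
    have hcov : ∀ z : G.nodes, (z : Pt d) ∈ G.box (3 * H / 2 + R₀) x →
        ∃ k ∈ s, (z : Pt d) ∈ G.box (H / 2) (cellCenter H k) := by
      intro z hz
      obtain ⟨k, hk, hzk⟩ := G.exists_cell hHpos hside hz.1
      refine ⟨k, ?_, hzk⟩
      rw [hs, Finset.mem_filter, Fintype.mem_piFinset]
      refine ⟨fun j => Finset.mem_range.2 ?_, hk⟩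
      have h3 := (G.box_cellCenter_bounds hzk j).1
      have h4 := (abs_le.1 (G.box_subset_closedBox _ _ hz j)).2
      rw [hx, cellCenter_apply] at h4
      have h5 := hm1 j
      have h6 : H * (k j : ℝ) < H * 4 := by nlinarith
      have h7 := lt_of_mul_lt_mul_left h6 hHpos.le
      exact_mod_cast h7
    refine (massForm_le_sum s hcov 1).trans ?_
    refine (Finset.sum_le_card_nsmul s _ (σ * ρ * H ^ d) fun k hk =>
      (mass_cell hG hH hside (Finset.mem_filter.1 hk).2).2).trans ?_
    rw [nsmul_eq_mul]
    have h3 : (s.card : ℝ) ≤ 4 ^ d := by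
      have : s.card ≤ 4 ^ d := by
        refine (Finset.card_filter_le _ _).trans ?_
        simp [Fintype.card_piFinset]
      exact_mod_cast this
    have h4 := one_le_sigma hG hH hside
    gcongr
  -- lower bound for the deviation from `c`, on one of the two outer elements
  have h3 : (H / 2) ^ 2 * (ρ * H ^ d) ≤
      G.massForm (G.box (3 * H / 2) x) (fun z => v z - c) := by
    have hsub : ∀ m : ℕ, m < 3 → G.box (H / 2) (cellCenter H (Pi.single i m)) ⊆
        G.box (3 * H / 2) x := by
      intro m hm z hz
      refine ⟨hz.1, fun j => ?_⟩
      obtain ⟨h4, h5⟩ := G.box_cellCenter_bounds hz j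
      have hside0 := (hz.1 j)
      rw [hx, cellCenter_apply]
      by_cases hj : j = i
      · subst hj
        simp only [hkm, Pi.single_eq_same, Nat.cast_one] at h4 h5 ⊢
        have h6 : (m : ℝ) ≤ 2 := by exact_mod_cast (by omega : m ≤ 2)
        refine ⟨by linarith, ?_⟩
        have e : H * (1 + 1 / 2) + 3 * H / 2 = H * 3 := by ring
        rw [e]
        rcases h5 with h5 | ⟨h5, h7⟩
        · left; nlinarith
        · rcases (show H * ((m : ℝ) + 1) ≤ H * 3 by nlinarith).lt_or_eq with h8 | h8
          · left; linarith
          · right; exact ⟨by rw [← h8, h5], by rw [h7, h8]⟩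
      · simp only [hkm, Pi.single_eq_of_ne hj, Nat.cast_zero] at h4 h5 ⊢
        refine ⟨by linarith, Or.inl ?_⟩
        rcases h5 with h5 | ⟨-, h5⟩ <;> linarith
    have hout : ∀ m : ℕ, m < 3 → (∀ z ∈ G.box (H / 2) (cellCenter H (Pi.single i m)),
        (H / 2) ^ 2 ≤ (z i - c) ^ 2) → (H / 2) ^ 2 * (ρ * H ^ d) ≤
          G.massForm (G.box (3 * H / 2) x) (fun z => v z - c) := by
      intro m hm hz
      calc (H / 2) ^ 2 * (ρ * H ^ d)
          ≤ (H / 2) ^ 2 * G.massForm (G.box (H / 2) (cellCenter H (Pi.single i m))) 1 := by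
            gcongr
            exact (mass_cell hG hH hside (hkN m hm)).1
        _ ≤ G.massForm (G.box (H / 2) (cellCenter H (Pi.single i m))) (fun z => v z - c) :=
            G.massForm_mul_sq_le _ fun z h => hz z h
        _ ≤ _ := G.massForm_mono _ fun z h => hsub m hm h
    rcases le_total (3 * H / 2) c with h4 | h4
    · refine hout 0 (by norm_num) fun z hz => ?_
      have h5 := (abs_le.1 (G.box_subset_closedBox _ _ hz i)).2
      rw [cellCenter_apply, Pi.single_eq_same, Nat.cast_zero] at h5
      nlinarith
    · refine hout 2 (by norm_num) fun z hz => ?_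
      have h5 := (G.box_cellCenter_bounds hz i).1
      rw [Pi.single_eq_same] at h5
      push_cast at h5
      nlinarith
  have h4 : H ^ 2 * (ρ * H ^ d) * 1 ≤ H ^ 2 * (ρ * H ^ d) * (9 * 4 ^ d * (σ * μ ^ 2)) := by
    have h5 := mul_le_mul_of_nonneg_left h2 (sq_nonneg (μ * (3 * H / 2)))
    have h6 := h3.trans (h1.trans h5)
    calc H ^ 2 * (ρ * H ^ d) * 1 = 4 * ((H / 2) ^ 2 * (ρ * H ^ d)) := by ring
      _ ≤ 4 * ((μ * (3 * H / 2)) ^ 2 * (4 ^ d * (σ * ρ * H ^ d))) := by gcongr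
      _ = _ := by ring
  exact le_of_mul_le_mul_left h4 (by positivity)

/-! ### Stable decomposition with respect to the mesh -/

theorem overlapLE_of_abs_le (hH : 0 < H) {ω : ((i : Fin d) → Fin (N i + 1)) → Set (Pt d)}
    (hω : ∀ a, ∀ z ∈ ω a, ∀ i, |z i - H * (a i : ℕ)| ≤ 3 * H) : G.OverlapLE ω (7 ^ d) := by
  classical
  intro x
  refine le_trans ?_ (card_near_le (N := N) hH (x : Pt d))
  exact_mod_cast Finset.card_le_card fun a ha => by
    simp only [Finset.mem_filter, Finset.mem_univ, true_and] at ha ⊢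
    exact hω a _ ha

theorem overlapLE_box (hH : 0 < H) {R : ℝ} (hR : R ≤ 3 * H) :
    G.OverlapLE (fun a : (i : Fin d) → Fin (N i + 1) => G.box R (meshNode H a)) (7 ^ d) :=
  overlapLE_of_abs_le hH fun _ _ hz i => (G.box_subset_closedBox _ _ hz i).trans hR

theorem overlapLE_patch (hH : 0 < H) :
    G.OverlapLE (fun a : (i : Fin d) → Fin (N i + 1) => G.patch H {meshNode H a}) (7 ^ d) :=
  overlapLE_of_abs_le hH fun _ _ hz i => (G.abs_le_of_mem_patch hz i).trans (by linarith)

theorem mem_box_of_abs_lt {R : ℝ} {x z : Pt d} (hz : z ∈ G.Ω) (h : ∀ i, |z i - x i| < R) :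
    z ∈ G.box R x := by
  refine ⟨hz, fun i => ?_⟩
  obtain ⟨h1, h2⟩ := abs_lt.1 (h i)
  exact ⟨by linarith, Or.inl (by linarith)⟩

theorem isPartitionOfUnity_nodalBasis (hG : G.NetworkAssumption R₀ σ ρ) (hH : 2 * R₀ ≤ H)
    (hside : ∀ i, G.side i = N i * H) :
    IsPartitionOfUnity (G := G)
      (fun (a : (i : Fin d) → Fin (N i + 1)) x => nodalBasis H a (x : Pt d))
      (fun a => G.box (2 * H) (meshNode H a)) (7 ^ d) (d / H) := by
  have hR₀ := hG.scale_pos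
  have hHpos : 0 < H := by linarith
  refine ⟨fun a x => nodalBasis_nonneg H a x, fun x => sum_nodalBasis_eq_one hHpos fun i => ?_,
    fun a x y => abs_nodalBasis_sub_le hHpos a x y, fun a x hx => ?_, fun a x y hadj hx => ?_,
    overlapLE_box hHpos (by linarith)⟩
  · rw [← hside]; exact G.nodes_mem x x.2 i
  · by_contra h
    refine hx (mem_box_of_abs_lt (G.nodes_mem x x.2) fun i => ?_)
    have := abs_lt_of_nodalBasis_ne_zero hHpos h i
    rw [meshNode_apply]
    linarith
  · by_contra h
    refine hx (mem_box_of_abs_lt (G.nodes_mem x x.2) fun i => ?_)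
    have h1 := abs_lt_of_nodalBasis_ne_zero hHpos h i
    have h2 : |(x : Pt d) i - (y : Pt d) i| ≤ _ :=
      PiLp.norm_apply_le ((x : Pt d) - (y : Pt d)) i
    have h3 := hG.locality x y hadj
    have h4 := abs_sub_le ((x : Pt d) i) ((y : Pt d) i) (H * (a i : ℕ))
    rw [meshNode_apply]
    linarith

theorem meshNode_mem_Ω (hH : 0 < H) (hside : ∀ i, G.side i = N i * H)
    (a : (i : Fin d) → Fin (N i + 1)) : meshNode H a ∈ G.Ω := by
  intro i
  rw [meshNode_apply, hside]
  have h : ((a i : ℕ) : ℝ) ≤ N i := by exact_mod_cast Nat.lt_succ_iff.1 (a i).is_lt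
  exact ⟨by positivity, by nlinarith⟩

/-- The Poincaré and Friedrichs inequalities on the boxes around the mesh nodes provide the
coefficients of a coarse function such that the decomposition is stable. -/
theorem exists_stable_coefficients (hG : G.NetworkAssumption R₀ σ ρ) (hH : 2 * R₀ ≤ H)
    (hside : ∀ i, G.side i = N i * H) (hμ : G.IsPoincareConstant R₀ μ) {v : G.Fun}
    (hv : v ∈ G.dirichlet) :
    ∃ c : ((i : Fin d) → Fin (N i + 1)) → ℝ, (∀ a, meshNode H a ∈ G.Γ → c a = 0) ∧
      G.lapForm G.Ω (fun x => ∑ a, c a * nodalBasis H a (x : Pt d)) +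
        ∑ a : (i : Fin d) → Fin (N i + 1), G.lapForm G.Ω
          (fun x => nodalBasis H a (x : Pt d) * (v x - ∑ b, c b * nodalBasis H b (x : Pt d))) ≤
      (4 + 28 * (d * 7 ^ d) ^ 2 * μ ^ 2) * G.lapForm G.Ω v := by
  classical
  have hR₀ := hG.scale_pos
  have hHpos : 0 < H := by linarith
  have hc : ∀ a : (i : Fin d) → Fin (N i + 1), ∃ c : ℝ, (meshNode H a ∈ G.Γ → c = 0) ∧
      G.massNorm (G.box (2 * H) (meshNode H a)) (fun z => v z - c) ≤
        μ * (2 * H) * G.lapNorm (G.box (2 * H + R₀) (meshNode H a)) v := by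
    intro a
    have hmem := meshNode_mem_Ω hHpos hside a
    by_cases ha : meshNode H a ∈ G.Γ
    · obtain ⟨x, hx, hxΓ, hxa⟩ := hG.boundary_density _ ha
      refine ⟨0, fun _ => rfl, ?_⟩
      simp only [sub_zero]
      refine hμ.friedrichs (2 * H) (by linarith) _ hmem ⟨x, hx, hxΓ,
        mem_box_of_abs_lt (G.nodes_mem x hx) fun i => ?_⟩ v hv
      have h1 : |x i - meshNode H a i| ≤ _ := PiLp.norm_apply_le (x - meshNode H a) i
      linarith
    · obtain ⟨c, hc⟩ := hμ.poincare (2 * H) (by linarith) _ hmem v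
      exact ⟨c, fun h => absurd h ha, hc⟩
  choose c hc0 hc using hc
  refine ⟨c, hc0, ((isPartitionOfUnity_nodalBasis hG hH hside).stable_decomposition
    (by positivity) v c).trans ?_⟩
  have h1 : ∑ a, G.massForm (G.box (2 * H) (meshNode H a)) (fun x => v x - c a) ≤
      (μ * (2 * H)) ^ 2 * (7 ^ d * G.lapForm G.Ω v) := by
    refine (Finset.sum_le_sum fun a _ => G.massForm_le_of_massNorm_le (hc a)).trans ?_
    rw [← Finset.mul_sum]
    exact mul_le_mul_of_nonneg_left
      ((overlapLE_box hHpos (by linarith)).sum_lapForm_le v) (sq_nonneg _)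
  calc _ ≤ 4 * G.lapForm G.Ω v + 7 * (7 ^ d * (d / H) ^ 2) *
        ((μ * (2 * H)) ^ 2 * (7 ^ d * G.lapForm G.Ω v)) := by gcongr
    _ = _ := by field_simp; ring

end SpatialNetwork

/-! ### The preconditioned conjugate gradient method with an additive Schwarz preconditioner -/

section AdditiveSchwarz

variable {F : Type*} [AddCommGroup F] [Module ℝ F] [FiniteDimensional ℝ F]

/-- Existence of the Galerkin projection onto a subspace. -/
theorem exists_galerkin_projection (core : InnerProductSpace.Core ℝ F) (W : Submodule ℝ F)
    (x : F) : ∃ w ∈ W, ∀ v ∈ W, core.inner w v = core.inner x v := by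
  let _ : NormedAddCommGroup F := core.toNormedAddCommGroup
  let _ : InnerProductSpace ℝ F := InnerProductSpace.ofCore core.toCore
  refine ⟨W.starProjection x, W.starProjection_apply_mem x, fun v hv => ?_⟩
  have h := W.starProjection_inner_eq_zero x v hv
  rw [inner_sub_left, sub_eq_zero] at h
  exact h.symm

/-- The convergence rate of the preconditioned conjugate gradient method, for the preconditioned
operator `∑ j, S j` with the Galerkin projections `S j` onto the subspaces `W j`, from a
strengthened triangle inequality with constant `Λ` and stable decompositions with constant `C₀`. -/
theorem additiveSchwarz_pcg_le (core : InnerProductSpace.Core ℝ F) {ι : Type*} [Fintype ι]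
    {W : ι → Submodule ℝ F} {S : ι → F → F} (hS : ∀ j x, S j x ∈ W j)
    (hSi : ∀ j x, ∀ v ∈ W j, core.inner (S j x) v = core.inner x v)
    {e p : ℕ → F} (h0 : p 0 = ∑ j, S j (e 0))
    (he : ∀ k, e (k + 1) = e k -
      (core.inner (∑ j, S j (e k)) (e k) / core.inner (p k) (p k)) • p k)
    (hp : ∀ k, p (k + 1) = ∑ j, S j (e (k + 1)) +
      (core.inner (∑ j, S j (e (k + 1))) (e (k + 1)) /
        core.inner (∑ j, S j (e k)) (e k)) • p k)
    {Λ C₀ s : ℝ} (hΛ0 : 0 ≤ Λ) (hC₀ : 0 < C₀) (hs : 1 < s) (hκ : Λ * C₀ ≤ s ^ 2)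
    (hΛ : ∀ w : ι → F, (∀ j, w j ∈ W j) →
      core.inner (∑ j, w j) (∑ j, w j) ≤ Λ * ∑ j, core.inner (w j) (w j))
    (hC : ∀ x : F, ∃ w : ι → F, (∀ j, w j ∈ W j) ∧ ∑ j, w j = x ∧
      ∑ j, core.inner (w j) (w j) ≤ C₀ * core.inner x x) (ℓ : ℕ) :
    √(core.inner (e ℓ) (e ℓ)) ≤
      2 * ((s - 1) / (s + 1)) ^ ℓ * √(core.inner (e 0) (e 0)) := by
  let _ : NormedAddCommGroup F := core.toNormedAddCommGroup
  let _ : InnerProductSpace ℝ F := InnerProductSpace.ofCore core.toCore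
  have hsq : ∀ x : F, core.inner x x = ‖x‖ ^ 2 := fun x => real_inner_self_eq_norm_sq x
  have hSP : ∀ x, ∑ j, S j x = schwarzOperator W x := by
    intro x
    rw [schwarzOperator_apply]
    refine Finset.sum_congr rfl fun j _ => ?_
    refine (Submodule.eq_starProjection_of_mem_of_inner_eq_zero (hS j x) fun v hv => ?_).symm
    rw [inner_sub_left, sub_eq_zero]
    exact (hSi j x v hv).symm
  simp only [hSP] at h0 he hp
  simp only [hsq] at hΛ hC ⊢
  rw [Real.sqrt_sq (norm_nonneg _), Real.sqrt_sq (norm_nonneg _)]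
  have hseq : IsPCGSequence (schwarzOperator W) e p := ⟨h0, he, hp⟩
  refine hseq.norm_error_le schwarzOperator_isSymmetric (inv_pos.2 hC₀) hs
    (le_inner_schwarzOperator hC₀ hC) (fun x => (inner_schwarzOperator_le hΛ0 hΛ x).trans ?_) ℓ
  gcongr
  rw [← div_eq_mul_inv, le_div_iff₀ hC₀]
  exact hκ

end AdditiveSchwarz

namespace SpatialNetwork

variable {d : ℕ} {G : SpatialNetwork d} {n : ℕ} {K : G.VFun n →ₗ[ℝ] G.VFun n}
  {α β H R₀ σ ρ μ : ℝ} {N : Fin d → ℕ}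

/-! ### The energy inner product -/

theorem ip_comm (u v : G.VFun n) : G.ip u v = G.ip v u := by
  simp only [ip, mul_comm]

theorem ip_add_left (u v w : G.VFun n) : G.ip (u + v) w = G.ip u w + G.ip v w := by
  simp only [ip, Pi.add_apply, add_mul, Finset.sum_add_distrib]

theorem ip_smul_left (t : ℝ) (u v : G.VFun n) : G.ip (t • u) v = t * G.ip u v := by
  simp only [ip, Pi.smul_apply, smul_eq_mul, mul_assoc, Finset.mul_sum]

theorem ip_sub_left (u v w : G.VFun n) : G.ip (u - v) w = G.ip u w - G.ip v w := by
  simp only [ip, Pi.sub_apply, sub_mul, Finset.sum_sub_distrib]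

theorem vlapForm_nonneg (v : G.VFun n) : 0 ≤ G.vlapForm v :=
  Finset.sum_nonneg fun _ _ => G.lapForm_nonneg _ _

namespace OperatorAssumption

theorem energy_nonneg (hK : G.OperatorAssumption K α β) {v : G.VFun n}
    (hv : v ∈ G.vdirichlet n) : 0 ≤ G.ip (K v) v :=
  (mul_nonneg hK.alpha_pos.le (vlapForm_nonneg v)).trans (hK.coercive v hv)

/-- A semidefinite form with unique solvability is definite. -/
theorem eq_zero_of_energy (hK : G.OperatorAssumption K α β) {v : G.VFun n}
    (hv : v ∈ G.vdirichlet n) (h : G.ip (K v) v = 0) : v = 0 := by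
  have horth : ∀ w ∈ G.vdirichlet n, G.ip (K v) w = 0 := by
    intro w hw
    set b := G.ip (K v) w with hb
    set c := G.ip (K w) w with hc
    have hc0 : 0 ≤ c := hK.energy_nonneg hw
    have hq : ∀ t : ℝ, 0 ≤ 2 * t * b + t ^ 2 * c := by
      intro t
      have h1 := hK.energy_nonneg (Submodule.add_mem _ hv (Submodule.smul_mem _ t hw))
      rw [map_add, map_smul, ip_add_left, ip_smul_left, ip_comm (K v), ip_comm (K w),
        ip_add_left, ip_add_left, ip_smul_left, ip_smul_left, ip_comm v (K v),
        ip_comm w (K v), ip_comm v (K w), ip_comm w (K w), hK.symmetric w v, h, ← hb, ← hc] at h1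
      linarith
    by_contra hne
    have h2 := hq (-b / (c + 1))
    have h3 : 2 * (-b / (c + 1)) * b + (-b / (c + 1)) ^ 2 * c =
        -(b ^ 2 * (c + 2)) / (c + 1) ^ 2 := by
      have : c + 1 ≠ 0 := by positivity
      field_simp
      ring
    rw [h3, le_div_iff₀ (by positivity), zero_mul] at h2
    have : 0 < b ^ 2 * (c + 2) := by positivity
    linarith
  have hzero : ∀ w : G.VFun n, G.ip 0 w = 0 := fun w => by simp [ip]
  refine (hK.uniquely_solvable 0).unique (y₁ := v) (y₂ := 0)
    ⟨hv, fun w hw => by rw [horth w hw, hzero]⟩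
    ⟨Submodule.zero_mem _, fun w _ => by rw [map_zero]⟩

/-- The energy inner product `(K u, v)` on the functions that satisfy the boundary condition. -/
@[reducible] noncomputable def energyCore (hK : G.OperatorAssumption K α β) :
    InnerProductSpace.Core ℝ (G.vdirichlet n) where
  inner u v := G.ip (K u) v
  conj_inner_symm u v := hK.symmetric v u
  re_inner_nonneg u := hK.energy_nonneg u.2
  add_left u v w := by rw [Submodule.coe_add, map_add, ip_add_left]
  smul_left u v t := by rw [Submodule.coe_smul, map_smul, ip_smul_left]; rfl
  definite u hu := Subtype.ext (hK.eq_zero_of_energy u.2 hu)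

theorem alpha_le_beta (hK : G.OperatorAssumption K α β) {v : G.VFun n}
    (hv : v ∈ G.vdirichlet n) (hne : v ≠ 0) : α ≤ β := by
  have h1 : 0 < G.ip (K v) v :=
    (hK.energy_nonneg hv).lt_of_ne fun h => hne (hK.eq_zero_of_energy hv h.symm)
  have h2 := hK.coercive v hv
  have h3 := hK.bounded v hv
  have h4 : 0 < G.vlapForm v := by
    refine (vlapForm_nonneg v).lt_of_ne fun h => ?_
    rw [← h, mul_zero] at h3
    linarith
  exact le_of_mul_le_mul_right (h2.trans h3) h4

end OperatorAssumption

/-! ### The subspaces of the preconditioner -/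

/-- The subspaces of the additive Schwarz method: `none` stands for the coarse space, `some a` for
the functions supported in the patch of the mesh node with multi-index `a`. -/
def schwarzSpace (G : SpatialNetwork d) (H : ℝ) (N : Fin d → ℕ) (n : ℕ) :
    Option ((i : Fin d) → Fin (N i + 1)) → Submodule ℝ (G.VFun n)
  | none => G.coarseSpace H n
  | some a => G.localSpace n (G.patch H {meshNode H a})

theorem schwarzSpace_le (j : Option ((i : Fin d) → Fin (N i + 1))) :
    G.schwarzSpace H N n j ≤ G.vdirichlet n := by
  cases j with
  | none =>
    intro v hv i hi x hx
    obtain ⟨q, hq, hqv⟩ := hv i hi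
    rw [← hqv]
    exact hq.2.2 x hx
  | some a => exact fun v hv => hv.1

theorem schwarz_eq_sum (r : G.VFun n) :
    G.schwarz K H N r = ∑ j, G.subspaceSolve K (G.schwarzSpace H N n j) r := by
  rw [Fintype.sum_option]
  rfl

theorem subspaceSolve_mem (W : Submodule ℝ (G.VFun n)) (r : G.VFun n) :
    G.subspaceSolve K W r ∈ W := by
  unfold subspaceSolve
  split_ifs with h
  · exact h.choose_spec.1
  · exact W.zero_mem

theorem subspaceSolve_congr {W : Submodule ℝ (G.VFun n)} {r r' : G.VFun n}
    (h : ∀ v ∈ W, G.ip r v = G.ip r' v) : G.subspaceSolve K W r = G.subspaceSolve K W r' := by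
  have : G.IsSolutionOn K W r = G.IsSolutionOn K W r' := by
    funext w
    exact propext (and_congr_right fun _ => forall₂_congr fun v hv => by rw [h v hv])
  unfold subspaceSolve
  generalize G.IsSolutionOn K W r = P at this
  subst this
  rfl

theorem subspaceSolve_spec (hK : G.OperatorAssumption K α β) {W : Submodule ℝ (G.VFun n)}
    (hW : W ≤ G.vdirichlet n) {x : G.VFun n} (hx : x ∈ G.vdirichlet n) {v : G.VFun n}
    (hv : v ∈ W) : G.ip (K (G.subspaceSolve K W (K x))) v = G.ip (K x) v := by
  have hex : ∃ w, G.IsSolutionOn K W (K x) w := by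
    obtain ⟨w, hw, h⟩ := exists_galerkin_projection hK.energyCore
      (W.comap (G.vdirichlet n).subtype) ⟨x, hx⟩
    exact ⟨w, hw, fun v hv => h ⟨v, hW hv⟩ hv⟩
  rw [subspaceSolve, dif_pos hex]
  exact hex.choose_spec.2 v hv

theorem schwarz_mem (r : G.VFun n) : G.schwarz K H N r ∈ G.vdirichlet n := by
  rw [schwarz_eq_sum]
  exact Submodule.sum_mem _ fun j _ => schwarzSpace_le j (subspaceSolve_mem _ _)

/-- The strengthened triangle inequality for the subspaces of the preconditioner. -/
theorem energy_sum_le (hK : G.OperatorAssumption K α β) (hβ : 0 ≤ β) (hH : 0 < H)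
    {w : Option ((i : Fin d) → Fin (N i + 1)) → G.VFun n}
    (hw : ∀ j, w j ∈ G.schwarzSpace H N n j) :
    G.ip (K (∑ j, w j)) (∑ j, w j) ≤ 4 * 7 ^ d * (β / α) * ∑ j, G.ip (K (w j)) (w j) := by
  have hα := hK.alpha_pos
  have hwV : ∀ j, w j ∈ G.vdirichlet n := fun j => schwarzSpace_le j (hw j)
  have h1 := hK.bounded _ (Submodule.sum_mem _ fun j (_ : j ∈ Finset.univ) => hwV j)
  have hd : (1 : ℝ) ≤ 7 ^ d := one_le_pow₀ (by norm_num)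
  have h2 : G.vlapForm (∑ j, w j) ≤ 4 * 7 ^ d * ∑ j, G.vlapForm (w j) := by
    unfold vlapForm
    rw [Finset.sum_comm, Finset.mul_sum]
    refine Finset.sum_le_sum fun i _ => ?_
    rw [Finset.sum_apply, Fintype.sum_option, Fintype.sum_option]
    have h3 := (overlapLE_patch (G := G) (N := N) hH).lapForm_sum_le (fun a => w (some a) i)
      fun a x hx => (hw (some a)).2 i x hx
    have h4 := G.lapForm_add_le (w none i) (∑ a, w (some a) i)
    have h5 := G.lapForm_nonneg G.Ω (w none i)
    nlinarith
  have h6 : ∑ j, G.vlapForm (w j) ≤ α⁻¹ * ∑ j, G.ip (K (w j)) (w j) := by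
    rw [Finset.mul_sum]
    refine Finset.sum_le_sum fun j _ => ?_
    rw [le_inv_mul_iff₀ hα]
    exact hK.coercive _ (hwV j)
  calc _ ≤ β * (4 * 7 ^ d * (α⁻¹ * ∑ j, G.ip (K (w j)) (w j))) := by
        refine h1.trans ?_
        gcongr
        exact h2.trans (by gcongr)
    _ = _ := by ring

/-- Stable decompositions with respect to the subspaces of the preconditioner. -/
theorem exists_stable_decomposition (hK : G.OperatorAssumption K α β) (hβ : 0 ≤ β)
    (hG : G.NetworkAssumption R₀ σ ρ) (hH : 2 * R₀ ≤ H) (hside : ∀ i, G.side i = N i * H)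
    (hΓ : G.MeshAligned H) (hμ : G.IsPoincareConstant R₀ μ) {v : G.VFun n}
    (hv : v ∈ G.vdirichlet n) :
    ∃ w : Option ((i : Fin d) → Fin (N i + 1)) → G.VFun n,
      (∀ j, w j ∈ G.schwarzSpace H N n j) ∧ ∑ j, w j = v ∧
      ∑ j, G.ip (K (w j)) (w j) ≤
        (4 + 28 * (d * 7 ^ d) ^ 2 * μ ^ 2) * (β / α) * G.ip (K v) v := by
  have hα := hK.alpha_pos
  have hR₀ := hG.scale_pos
  have hHpos : 0 < H := by linarith
  choose c hc0 hc using fun i => exists_stable_coefficients hG hH hside hμ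
    (hv i (Set.mem_univ i))
  set w : Option ((i : Fin d) → Fin (N i + 1)) → G.VFun n := fun j => match j with
    | none => fun i x => ∑ b, c i b * nodalBasis H b (x : Pt d)
    | some a => fun i x =>
      nodalBasis H a (x : Pt d) * (v i x - ∑ b, c i b * nodalBasis H b (x : Pt d)) with hw
  have hcoarse : w none ∈ G.coarseSpace H n := by
    intro i _
    refine ⟨∑ b, c i b • nodalBasis H b, Submodule.sum_mem _ fun b _ => ?_, ?_⟩
    · by_cases hb : meshNode H b ∈ G.Γ
      · rw [hc0 i b hb, zero_smul]; exact Submodule.zero_mem _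
      · exact Submodule.smul_mem _ _ (G.nodalBasis_mem_feSpace hHpos hΓ hb)
    · ext x
      simp [hw, LinearMap.funLeft_apply, Finset.sum_apply]
  have hmem : ∀ j, w j ∈ G.schwarzSpace H N n j := by
    intro j
    cases j with
    | none => exact hcoarse
    | some a =>
      refine ⟨fun i hi x hx => ?_, fun i x hx => ?_⟩
      · have h1 : v i x = 0 := hv i hi x hx
        have h2 : ∑ b, c i b * nodalBasis H b (x : Pt d) = 0 :=
          schwarzSpace_le (N := N) none hcoarse i hi x hx
        simp only [hw, h1, h2, sub_zero, mul_zero]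
      · by_contra hne
        exact hx (G.mem_patch_of_nodalBasis_ne_zero hHpos hside (G.nodes_mem x x.2)
          (left_ne_zero_of_mul hne))
  refine ⟨w, hmem, ?_, ?_⟩
  · rw [Fintype.sum_option]
    ext i x
    simp only [hw, Pi.add_apply, Finset.sum_apply]
    rw [← Finset.sum_mul, (isPartitionOfUnity_nodalBasis hG hH hside).sum_eq_one x, one_mul,
      add_sub_cancel]
  · have h1 : ∑ j, G.ip (K (w j)) (w j) ≤ β * ∑ j, G.vlapForm (w j) := by
      rw [Finset.mul_sum]
      exact Finset.sum_le_sum fun j _ => hK.bounded _ (schwarzSpace_le j (hmem j))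
    have h2 : ∑ j, G.vlapForm (w j) ≤
        (4 + 28 * (d * 7 ^ d) ^ 2 * μ ^ 2) * G.vlapForm v := by
      unfold vlapForm
      rw [Finset.sum_comm, Finset.mul_sum]
      refine Finset.sum_le_sum fun i _ => ?_
      rw [Fintype.sum_option]
      exact hc i
    have h3 : G.vlapForm v ≤ α⁻¹ * G.ip (K v) v := by
      rw [le_inv_mul_iff₀ hα]
      exact hK.coercive _ hv
    calc _ ≤ β * ((4 + 28 * (d * 7 ^ d) ^ 2 * μ ^ 2) * (α⁻¹ * G.ip (K v) v)) := by
          refine h1.trans ?_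
          gcongr
          exact h2.trans (by gcongr)
      _ = _ := by ring

/-! ### The iterates on the network -/

/-- The iterates and the search directions satisfy the boundary condition, and the residual is the
image of the error under `K`, when tested with functions that satisfy the boundary condition. -/
theorem pcg_invariant {f u u₀ : G.VFun n} (hu : G.IsSolutionOn K (G.vdirichlet n) f u)
    (hu₀ : u₀ ∈ G.vdirichlet n) (ℓ : ℕ) :
    (G.pcg K (G.schwarz K H N) f u₀ ℓ).sol ∈ G.vdirichlet n ∧
      (G.pcg K (G.schwarz K H N) f u₀ ℓ).dir ∈ G.vdirichlet n ∧
      ∀ v ∈ G.vdirichlet n, G.ip (G.pcg K (G.schwarz K H N) f u₀ ℓ).res v =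
        G.ip (K (u - (G.pcg K (G.schwarz K H N) f u₀ ℓ).sol)) v := by
  induction ℓ with
  | zero =>
    refine ⟨hu₀, schwarz_mem _, fun v hv => ?_⟩
    simp only [pcg]
    rw [map_sub, ip_sub_left, ip_sub_left, hu.2 v hv]
  | succ ℓ ih =>
    obtain ⟨h1, h2, h3⟩ := ih
    refine ⟨Submodule.add_mem _ h1 (Submodule.smul_mem _ _ h2),
      Submodule.add_mem _ (schwarz_mem _) (Submodule.smul_mem _ _ h2), fun v hv => ?_⟩
    simp only [pcg, pcgStep]
    rw [← sub_sub, map_sub, ip_sub_left, ip_sub_left, map_smul, h3 v hv]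

theorem pcgIterate_error_le (hK : G.OperatorAssumption K α β) (hβ : 0 < β)
    (hG : G.NetworkAssumption R₀ σ ρ) (hH : 2 * R₀ ≤ H) (hside : ∀ i, G.side i = N i * H)
    (hΓ : G.MeshAligned H) (hμ : G.IsPoincareConstant R₀ μ) {f u u₀ : G.VFun n}
    (hu : G.IsSolutionOn K (G.vdirichlet n) f u) (hu₀ : u₀ ∈ G.vdirichlet n) {s : ℝ}
    (hs : 1 < s) (hκ : 4 * 7 ^ d * (β / α) *
      ((4 + 28 * (d * 7 ^ d) ^ 2 * μ ^ 2) * (β / α)) ≤ s ^ 2) (ℓ : ℕ) :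
    G.energyNorm K (u - G.pcgIterate K H N f u₀ ℓ) ≤
      2 * ((s - 1) / (s + 1)) ^ ℓ * G.energyNorm K (u - u₀) := by
  have hα := hK.alpha_pos
  have hR₀ := hG.scale_pos
  have hHpos : 0 < H := by linarith
  have hinv := pcg_invariant (K := K) (H := H) (N := N) hu hu₀
  set st := G.pcg K (G.schwarz K H N) f u₀ with hst
  set e : ℕ → G.vdirichlet n := fun k => ⟨u - (st k).sol, Submodule.sub_mem _ hu.1 (hinv k).1⟩
    with he
  set p : ℕ → G.vdirichlet n := fun k => ⟨(st k).dir, (hinv k).2.1⟩ with hp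
  set S : Option ((i : Fin d) → Fin (N i + 1)) → G.vdirichlet n → G.vdirichlet n :=
    fun j x => ⟨G.subspaceSolve K (G.schwarzSpace H N n j) (K x),
      schwarzSpace_le j (subspaceSolve_mem _ _)⟩ with hS
  -- the preconditioner sees the residual only through the error
  have hB : ∀ k, G.schwarz K H N (st k).res = ((∑ j, S j (e k) : G.vdirichlet n) : G.VFun n) := by
    intro k
    rw [schwarz_eq_sum, Submodule.coe_sum]
    exact Finset.sum_congr rfl fun j _ =>
      subspaceSolve_congr fun v hv => (hinv k).2.2 v (schwarzSpace_le j hv)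
  have hrB : ∀ k, G.ip (st k).res (G.schwarz K H N (st k).res) =
      hK.energyCore.inner (∑ j, S j (e k)) (e k) := by
    intro k
    rw [(hinv k).2.2 _ (schwarz_mem _), hB]
    exact hK.symmetric _ _
  refine additiveSchwarz_pcg_le hK.energyCore (e := e) (p := p) (S := S)
    (W := fun j => (G.schwarzSpace H N n j).comap (G.vdirichlet n).subtype)
    (fun j x => subspaceSolve_mem _ _)
    (fun j x v hv => subspaceSolve_spec hK (schwarzSpace_le j) x.2 hv)
    (Subtype.ext (hB 0)) (fun k => Subtype.ext ?_) (fun k => Subtype.ext ?_)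
    (by positivity) (by positivity) hs hκ (fun w hw => ?_) (fun x => ?_) ℓ
  · rw [← hrB]
    exact (sub_sub _ _ _).symm
  · rw [← hrB, ← hrB, Submodule.coe_add, ← hB]
    rfl
  · have h := energy_sum_le hK hβ.le hHpos (w := fun j => (w j : G.VFun n)) hw
    rw [← Submodule.coe_sum] at h
    exact h
  · obtain ⟨w, hw, hsum, hle⟩ :=
      exists_stable_decomposition hK hβ.le hG hH hside hΓ hμ x.2
    refine ⟨fun j => ⟨w j, schwarzSpace_le j (hw j)⟩, hw, Subtype.ext ?_, hle⟩
    rw [Submodule.coe_sum]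
    exact hsum

end SpatialNetwork

theorem theorem4p1 (d : ℕ) :
    ∃ C : ℝ, 0 < C ∧
      ∀ (G : SpatialNetwork d) (n : ℕ) (K : G.VFun n →ₗ[ℝ] G.VFun n)
        (α β R₀ σ ρ H : ℝ) (N : Fin d → ℕ),
        G.OperatorAssumption K α β →
        G.NetworkAssumption R₀ σ ρ →
        2 * R₀ ≤ H →
        (∀ i, G.side i = N i * H) →
        G.MeshAligned H →
        (∃ μ : ℝ, G.IsPoincareConstant R₀ μ) ∧
        ∀ μ : ℝ, G.IsPoincareConstant R₀ μ →
          ((∃ i, 3 ≤ N i) ∨ 1 ≤ √σ * μ) →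
          ∀ f u u₀ : G.VFun n,
            G.IsSolutionOn K (G.vdirichlet n) f u →
            u₀ ∈ G.vdirichlet n →
            ∀ ℓ : ℕ,
              let sqrtκ : ℝ := C * β * α⁻¹ * √σ * μ
              G.energyNorm K (u - G.pcgIterate K H N f u₀ ℓ) ≤
                2 * ((sqrtκ - 1) / (sqrtκ + 1)) ^ ℓ * G.energyNorm K (u - u₀) := by
  set c₁ : ℝ := 9 * 4 ^ d with hc₁
  set c₂ : ℝ := 28 * (d * 7 ^ d) ^ 2 with hc₂
  have hc₁1 : 1 ≤ c₁ := by
    have : (1 : ℝ) ≤ 4 ^ d := one_le_pow₀ (by norm_num)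
    rw [hc₁]; linarith
  have hc₂0 : 0 ≤ c₂ := by positivity
  have h7 : (1 : ℝ) ≤ 7 ^ d := one_le_pow₀ (by norm_num)
  set C : ℝ := 4 * 7 ^ d * (4 * c₁ + c₂) with hC
  have hCc : c₁ < C := by rw [hC]; nlinarith
  have hCC : C ≤ C ^ 2 := by nlinarith
  refine ⟨C, by linarith, ?_⟩
  intro G n K α β R₀ σ ρ H N hK hG hH hside hΓ
  refine ⟨SpatialNetwork.exists_isPoincareConstant hG, ?_⟩
  intro μ hμ hor f u u₀ hu hu₀ ℓ
  have hα := hK.alpha_pos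
  by_cases htriv : ∀ v ∈ G.vdirichlet n, v = 0
  · -- without free nodes there is no error; `β` may be anything in this case
    have h1 : u - G.pcgIterate K H N f u₀ ℓ = 0 :=
      htriv _ (Submodule.sub_mem _ hu.1 (SpatialNetwork.pcg_invariant hu hu₀ ℓ).1)
    have h2 : u - u₀ = 0 := htriv _ (Submodule.sub_mem _ hu.1 hu₀)
    have h3 : G.energyNorm K 0 = 0 := by simp [SpatialNetwork.energyNorm, SpatialNetwork.ip]
    intro sqrtκ
    rw [h1, h2, h3, mul_zero]
  push Not at htriv
  obtain ⟨v, hv, hne⟩ := htriv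
  have hαβ := hK.alpha_le_beta hv hne
  have hβ : 0 < β := hα.trans_le hαβ
  have hσ := SpatialNetwork.one_le_sigma hG hH hside
  have hγ : 1 ≤ β / α := (one_le_div hα).2 hαβ
  have hσμ : 1 ≤ c₁ * (σ * μ ^ 2) := by
    rcases hor with ⟨i, hi⟩ | h
    · exact SpatialNetwork.one_le_of_three_le hG hH hside hμ hi
    · have h1 : 1 ≤ (√σ * μ) ^ 2 := one_le_pow₀ h
      rw [mul_pow, Real.sq_sqrt (by linarith)] at h1
      nlinarith
  have hμ0 := hμ.nonneg
  have hsq : (C * β * α⁻¹ * √σ * μ) ^ 2 = C ^ 2 * (β / α) ^ 2 * (σ * μ ^ 2) := by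
    rw [mul_pow, mul_pow _ √σ, Real.sq_sqrt (by linarith)]
    ring
  have hσμ0 : 0 ≤ σ * μ ^ 2 := by positivity
  have hγ2 : 1 ≤ (β / α) ^ 2 := one_le_pow₀ hγ
  refine SpatialNetwork.pcgIterate_error_le hK hβ hG hH hside hΓ hμ hu hu₀ ?_ ?_ ℓ
  · have h1 : 1 < C * (σ * μ ^ 2) := by
      rcases hσμ0.eq_or_lt with h0 | h0
      · rw [← h0] at hσμ; linarith
      · nlinarith
    have h2 : C * (σ * μ ^ 2) ≤ (C * β * α⁻¹ * √σ * μ) ^ 2 := by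
      rw [hsq]
      refine mul_le_mul_of_nonneg_right ?_ hσμ0
      nlinarith
    refine lt_of_pow_lt_pow_left₀ 2 (by positivity) ?_
    rw [one_pow]
    linarith
  · rw [hsq]
    have h1 : 4 + c₂ * μ ^ 2 ≤ (4 * c₁ + c₂) * (σ * μ ^ 2) := by
      have : μ ^ 2 ≤ σ * μ ^ 2 := le_mul_of_one_le_left (sq_nonneg μ) hσ
      nlinarith
    calc 4 * 7 ^ d * (β / α) * ((4 + c₂ * μ ^ 2) * (β / α))
        ≤ 4 * 7 ^ d * (β / α) * ((4 * c₁ + c₂) * (σ * μ ^ 2) * (β / α)) := by gcongr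
      _ = C * (β / α) ^ 2 * (σ * μ ^ 2) := by rw [hC]; ring
      _ ≤ C ^ 2 * (β / α) ^ 2 * (σ * μ ^ 2) := by gcongr
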